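/- **Theorem 3.** A quantum prover-verifier interaction with $r \ge 1$ rounds is given by finite-dimensional Hilbert spaces $\mathcal X_1,\dots,\mathcal X_r$ (messages from the verifier to the prover), $\mathcal Y_1,\dots,\mathcal Y_r$ (messages from the prover to the verifier) and $\mathcal Z_1,\dots,\mathcal Z_r$ (the verifier's memory), a density operator $\rho$ on $\mathcal X_1\otimes\mathcal Z_1$, quantum channels $\Psi_i$ ($2\le i\le r$) from operators on $\mathcal Y_{i-1}\otimes\mathcal Z_{i-1}$ to operators on $\mathcal X_i\otimes\mathcal Z_i$, and a binary measurement (POVM) $\{P_0,P_1\}$ on $\mathcal Y_r\otimes\mathcal Z_r$, where outcome $1$ means that the prover wins. The verifier's actions are fixed by these data. The prover chooses finite-dimensional private memory spaces $\mathcal W_i$ and arbitrary channels $\Phi_1:\mathcal X_1\to\mathcal Y_1\otimes\mathcal W_1$ and $\Phi_i:\mathcal X_i\otimes\mathcal W_{i-1}\to\mathcal Y_i\otimes\mathcal W_i$ ($2\le i\le r$), and what is left in $\mathcal W_r$ at the end is discarded. In $n$ parallel instances the verifier acts independently and identically in the instances, that is, by $\rho^{\otimes n}$, $\Psi_i^{\otimes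 n}$ and the measurement $\{P_{o_1}\otimes\cdots\otimes P_{o_n}\}_{o\in\{0,1\}^n}$, while the prover may act jointly on all instances: he is any such prover for the message spaces $\mathcal X_i^{\otimes n}$, $\mathcal Y_i^{\otimes n}$. Optimal probabilities are suprema over all strategies of the prover. Let $p$ be the prover's optimal probability of winning a single instance of an arbitrary such interaction. Consider $n$ parallel instances, and let $k\in\mathbb N$ be such that $k=n(p+\delta)$ with $\delta>0$. Then the prover's optimal probability of winning at least $k$ of the $n$ parallel instances is at most $e^{-2n\delta^2}$. -/

import Mathlib

/-!
Finite-dimensional Hilbert spaces are the spaces `ℂ^A` with `A` a finite index type, operators on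
them are matrices, and `ℂ^A ⊗ ℂ^B` is `ℂ^(A × B)`.
-/

open scoped ComplexOrder

noncomputable section

namespace QPV

/-- `Φ ⊗ id_R`: the map `Φ` is applied to the `A`-part of an operator on `ℂ^A ⊗ ℂ^R`. -/
def ampliate {A B : Type*} (Φ : Matrix A A ℂ →ₗ[ℂ] Matrix B B ℂ) (R : Type*)
    (M : Matrix (A × R) (A × R) ℂ) : Matrix (B × R) (B × R) ℂ :=
  Matrix.of fun b b' => Φ (Matrix.of fun a a' => M (a, b.2) (a', b'.2)) b.1 b'.1

/-- Density operators: positive semidefinite of trace one. -/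
structure IsDensity {A : Type*} [Fintype A] (ρ : Matrix A A ℂ) : Prop where
  posSemidef : ρ.PosSemidef
  trace_eq_one : ρ.trace = 1

/-- Quantum channels: completely positive and trace-preserving linear maps. -/
structure IsChannel {A B : Type*} [Fintype A] [Fintype B]
    (Φ : Matrix A A ℂ →ₗ[ℂ] Matrix B B ℂ) : Prop where
  completelyPositive : ∀ (d : ℕ) (M : Matrix (A × Fin d) (A × Fin d) ℂ),
    M.PosSemidef → (ampliate Φ (Fin d) M).PosSemidef
  tracePreserving : ∀ M : Matrix A A ℂ, (Φ M).trace = M.trace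

/-- A measurement (POVM) with outcomes in `I`. -/
structure IsPOVM {I A : Type*} [Fintype I] [DecidableEq A]
    (P : I → Matrix A A ℂ) : Prop where
  posSemidef : ∀ i, (P i).PosSemidef
  sum_eq_one : ∑ i, P i = 1

/-- Exchange of the last two tensor factors of `ℂ^A ⊗ ℂ^B ⊗ ℂ^C`. -/
def exchange {A B C : Type*} (M : Matrix ((A × B) × C) ((A × B) × C) ℂ) :
    Matrix ((A × C) × B) ((A × C) × B) ℂ :=
  M.submatrix (fun t => ((t.1.1, t.2), t.1.2)) (fun t => ((t.1.1, t.2), t.1.2))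

/-- Partial trace over the second tensor factor. -/
def traceOut {A R : Type*} [Fintype R] (M : Matrix (A × R) (A × R) ℂ) : Matrix A A ℂ :=
  Matrix.of fun a a' => ∑ r, M (a, r) (a', r)

/-- The probability `tr (Q σ)` of the outcome with measurement operator `Q` in the state `σ`. -/
def bornProb {A : Type*} [Fintype A] (Q σ : Matrix A A ℂ) : ℝ :=
  (Q * σ).trace.re

/-- A prover-verifier interaction with `m + 1` messages in each direction, the verifier sending
the first one. `X i`, `Y i` are the message spaces of round `i` (verifier to prover, prover to
verifier) and `Z i` is the verifier's memory after sending the message of round `i`. -/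
structure Interaction {m : ℕ} (X Y Z : Fin (m + 1) → Type)
    [∀ i, Fintype (X i)] [∀ i, Fintype (Y i)] [∀ i, Fintype (Z i)]
    [∀ i, DecidableEq (Y i)] [∀ i, DecidableEq (Z i)] where
  /-- the verifier's first message, together with the memory that the verifier keeps -/
  ρ : Matrix (X 0 × Z 0) (X 0 × Z 0) ℂ
  /-- the verifier's responses to all but the last of the prover's messages -/
  Ψ : ∀ i : Fin m, Matrix (Y i.castSucc × Z i.castSucc) (Y i.castSucc × Z i.castSucc) ℂ →ₗ[ℂ]
    Matrix (X i.succ × Z i.succ) (X i.succ × Z i.succ) ℂ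
  /-- the final binary measurement; outcome `1` means that the prover wins, `0` that he loses -/
  P : Fin 2 → Matrix (Y (Fin.last m) × Z (Fin.last m)) (Y (Fin.last m) × Z (Fin.last m)) ℂ
  isDensity_ρ : IsDensity ρ
  isChannel_Ψ : ∀ i, IsChannel (Ψ i)
  isPOVM_P : IsPOVM P

/-- A strategy of the prover for message spaces `X i`, `Y i`: memories `W i` of arbitrary finite
dimension, and channels `Φ_0 : X_0 → Y_0 ⊗ W_0` and `Φ_(i+1) : X_(i+1) ⊗ W_i → Y_(i+1) ⊗ W_(i+1)`.
What is left in the memory after the last message is discarded. -/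
structure Strategy {m : ℕ} (X Y : Fin (m + 1) → Type)
    [∀ i, Fintype (X i)] [∀ i, Fintype (Y i)] where
  W : Fin (m + 1) → Type
  [fintypeW : ∀ i, Fintype (W i)]
  first : Matrix (X 0) (X 0) ℂ →ₗ[ℂ] Matrix (Y 0 × W 0) (Y 0 × W 0) ℂ
  next : ∀ i : Fin m, Matrix (X i.succ × W i.castSucc) (X i.succ × W i.castSucc) ℂ →ₗ[ℂ]
    Matrix (Y i.succ × W i.succ) (Y i.succ × W i.succ) ℂ
  isChannel_first : IsChannel first
  isChannel_next : ∀ i, IsChannel (next i)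

attribute [instance] Strategy.fintypeW

/-- The joint state of the prover's message, the verifier's memory and the prover's memory after
the prover has sent his message of round `i`, if the verifier prepares `ρ` and responds by `Ψ`. -/
def run {m : ℕ} {X Y Z : Fin (m + 1) → Type} [∀ i, Fintype (X i)] [∀ i, Fintype (Y i)]
    (ρ : Matrix (X 0 × Z 0) (X 0 × Z 0) ℂ)
    (Ψ : ∀ i : Fin m, Matrix (Y i.castSucc × Z i.castSucc) (Y i.castSucc × Z i.castSucc) ℂ →ₗ[ℂ]
      Matrix (X i.succ × Z i.succ) (X i.succ × Z i.succ) ℂ)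
    (B : Strategy X Y) (i : Fin (m + 1)) :
    Matrix ((Y i × Z i) × B.W i) ((Y i × Z i) × B.W i) ℂ :=
  Fin.induction
    (motive := fun i => Matrix ((Y i × Z i) × B.W i) ((Y i × Z i) × B.W i) ℂ)
    (exchange (ampliate B.first (Z 0) ρ))
    (fun i σ => exchange (ampliate (B.next i) (Z i.succ)
      (exchange (ampliate (Ψ i) (B.W i.castSucc) σ))))
    i

/-- The tensor product of `n` operators on `ℂ^A`. -/
def tensor {n : ℕ} {A : Type*} (M : Fin n → Matrix A A ℂ) :
    Matrix (Fin n → A) (Fin n → A) ℂ :=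
  Matrix.of fun a a' => ∏ j, M j (a j) (a' j)

/-- The tensor power `Ψ^{⊗ n}` of a linear map, by its values on matrix units:
`Ψ^{⊗ n} (⨂ j, E_{a j, a' j}) = ⨂ j, Ψ (E_{a j, a' j})`. -/
def mapPow (n : ℕ) {A B : Type*} [Fintype A] [DecidableEq A]
    (Ψ : Matrix A A ℂ →ₗ[ℂ] Matrix B B ℂ) :
    Matrix (Fin n → A) (Fin n → A) ℂ →ₗ[ℂ] Matrix (Fin n → B) (Fin n → B) ℂ where
  toFun M := ∑ a, ∑ a', M a a' • tensor fun j => Ψ (Matrix.single (a j) (a' j) 1)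
  map_add' M N := by simp [add_smul, Finset.sum_add_distrib]
  map_smul' c M := by simp [mul_smul, Finset.smul_sum]

/-- The identification `(ℂ^A ⊗ ℂ^B)^{⊗ n} = (ℂ^A)^{⊗ n} ⊗ (ℂ^B)^{⊗ n}`, on operators. -/
def regroup (n : ℕ) (A B : Type*) :
    Matrix (Fin n → A × B) (Fin n → A × B) ℂ ≃ₗ[ℂ]
      Matrix ((Fin n → A) × (Fin n → B)) ((Fin n → A) × (Fin n → B)) ℂ :=
  Matrix.reindexLinearEquiv ℂ ℂ (Equiv.arrowProdEquivProdArrow (Fin n) (fun _ => A) (fun _ => B))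
    (Equiv.arrowProdEquivProdArrow (Fin n) (fun _ => A) (fun _ => B))

namespace Interaction

variable {m : ℕ} {X Y Z : Fin (m + 1) → Type}
  [∀ i, Fintype (X i)] [∀ i, Fintype (Y i)] [∀ i, Fintype (Z i)]
  [∀ i, DecidableEq (Y i)] [∀ i, DecidableEq (Z i)]

/-- The probability that the prover wins a single instance with the strategy `B`. -/
def winProb (V : Interaction X Y Z) (B : Strategy X Y) : ℝ :=
  bornProb (V.P 1) (traceOut (run V.ρ V.Ψ B (Fin.last m)))

/-- The winning probabilities that the prover can achieve in a single instance. -/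
def winProbs (V : Interaction X Y Z) : Set ℝ :=
  Set.range V.winProb

/-- The strategies of the prover in `n` parallel instances: in each round he receives the `n`
messages of the verifier together and answers them jointly. -/
abbrev ParallelStrategy (n : ℕ) (X Y : Fin (m + 1) → Type)
    [∀ i, Fintype (X i)] [∀ i, Fintype (Y i)] :=
  Strategy (fun i => Fin n → X i) (fun i => Fin n → Y i)

/-- The final state of `n` parallel instances: the verifier acts independently and identically in
the instances, that is, by `ρ^{⊗ n}` and `Ψ_i^{⊗ n}`. -/
def parallelState (V : Interaction X Y Z) (n : ℕ) (B : ParallelStrategy n X Y) :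
    Matrix ((Fin n → Y (Fin.last m)) × (Fin n → Z (Fin.last m)))
      ((Fin n → Y (Fin.last m)) × (Fin n → Z (Fin.last m))) ℂ :=
  traceOut (run (Z := fun i => Fin n → Z i)
    (regroup n (X 0) (Z 0) (tensor fun _ => V.ρ))
    (fun i => (regroup n (X i.succ) (Z i.succ)).toLinearMap ∘ₗ mapPow n (V.Ψ i) ∘ₗ
      (regroup n (Y i.castSucc) (Z i.castSucc)).symm.toLinearMap)
    B (Fin.last m))

/-- The probability that the outcomes of the `n` parallel instances are `o 0, …, o (n - 1)`. -/
def outcomeProb (V : Interaction X Y Z) (n : ℕ) (B : ParallelStrategy n X Y)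
    (o : Fin n → Fin 2) : ℝ :=
  bornProb (regroup n (Y (Fin.last m)) (Z (Fin.last m)) (tensor fun j => V.P (o j)))
    (V.parallelState n B)

/-- The probability that the prover wins at least `k` of the `n` parallel instances. -/
def atLeastProb (V : Interaction X Y Z) (n k : ℕ) (B : ParallelStrategy n X Y) : ℝ :=
  ∑ o : Fin n → Fin 2 with k ≤ (Finset.univ.filter fun j => o j = 1).card, V.outcomeProb n B o

/-- The probabilities of winning at least `k` of `n` parallel instances that the prover can
achieve. -/
def atLeastProbs (V : Interaction X Y Z) (n k : ℕ) : Set ℝ :=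
  Set.range (V.atLeastProb n k)

end Interaction

end QPV

end

noncomputable section

namespace QPV

open Matrix

/-! Every verifier can be simulated by a universal one, which sends halves of unnormalized maximally
entangled vectors and stores all messages; the specific actions of the verifier move into the final
measurement (`bornProb_run`). The state left by this interaction is the Choi operator `R` of the
strategy. Probabilities become `tr (C R)`, where `R` obeys only positivity and linear partial-trace
conditions (`isComb_comb`), so the optimum is a semidefinite program.

The dual (`Cert`) asks for operators with `1 ⊗ A_m ≥ C`, `1 ⊗ A_(i-1) ≥ tr_X A_i` and `tr A_0 ≤ 1`.
If `C ≥ 0`, all `A_i` are positive, and tensor powers preserve these inequalities (`Cert.pow`).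
Hence, by strong duality for one instance (`cert_of_forall_strategy`) and weak duality for `n`
(`Cert.trace_mul_le`), a positive `C` of value below `1` has tensor powers of value at most `1`.

This is applied to a multiple of `P_0 + s P_1`, with `s ≥ 1`. Its value is governed by `1 + (s - 1)
p`, and the tensor power averages `s ^ wins`. So `E[s ^ wins] ≤ (1 + (s - 1) p) ^ n`, the generating
function of `n` independent Bernoulli variables, even for correlated strategies. Markov's inequality
with `s = exp (4 δ)` and Hoeffding's lemma finish the proof.

For strong duality, an uncertified `C` is separated from the certified operators by some `R` in
their polar. Restricting `R` to earlier rounds gives a chain of Choi operators, and a small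
admixture of the completely mixed ones makes it positive definite, hence realizable by isometries
(`IsComb.exists_strategy`). -/

/-! ### Trace inequalities for positive semidefinite matrices. -/

open scoped MatrixOrder in
theorem exists_eq_mul_conjTranspose {A : Type*} [Fintype A] {M : Matrix A A ℂ}
    (hM : M.PosSemidef) : ∃ S : Matrix A A ℂ, M = S * Sᴴ := by
  classical
  obtain ⟨S, hS⟩ := CStarAlgebra.nonneg_iff_eq_star_mul_self.mp hM.nonneg
  exact ⟨Sᴴ, by rw [hS, conjTranspose_conjTranspose]; rfl⟩

theorem trace_mul_re_nonneg {A : Type*} [Fintype A] {M N : Matrix A A ℂ}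
    (hM : M.PosSemidef) (hN : N.PosSemidef) : 0 ≤ (M * N).trace.re := by
  obtain ⟨S, rfl⟩ := exists_eq_mul_conjTranspose hM
  rw [Matrix.mul_assoc, trace_mul_comm]
  exact (Complex.nonneg_iff.1 (hN.conjTranspose_mul_mul_same S).trace_nonneg).1

theorem trace_mul_re_mono {A : Type*} [Fintype A] {M M' N : Matrix A A ℂ}
    (hM : (M' - M).PosSemidef) (hN : N.PosSemidef) : (M * N).trace.re ≤ (M' * N).trace.re := by
  have := trace_mul_re_nonneg hM hN
  rw [sub_mul, trace_sub, Complex.sub_re] at this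
  linarith

/-! ### Ampliations, exchanges and partial traces -/

/-- Complete positivity, with auxiliary spaces `ℂ^d`. -/
def IsCompletelyPositive {A B : Type*} [Fintype A] [Fintype B]
    (Φ : Matrix A A ℂ →ₗ[ℂ] Matrix B B ℂ) : Prop :=
  ∀ (d : ℕ) (M : Matrix (A × Fin d) (A × Fin d) ℂ),
    M.PosSemidef → (ampliate Φ (Fin d) M).PosSemidef

theorem IsCompletelyPositive.ampliate {A B : Type*} [Fintype A] [Fintype B]
    {Φ : Matrix A A ℂ →ₗ[ℂ] Matrix B B ℂ} (hΦ : IsCompletelyPositive Φ) {R : Type*} [Fintype R]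
    {M : Matrix (A × R) (A × R) ℂ} (hM : M.PosSemidef) : (ampliate Φ R M).PosSemidef := by
  have e := Fintype.equivFin R
  have h := (hΦ _ (M.submatrix (fun t : A × Fin _ => (t.1, e.symm t.2))
    (fun t => (t.1, e.symm t.2))) (hM.submatrix _)).submatrix (fun t : B × R => (t.1, e t.2))
  convert h using 1
  ext b b'
  simp [QPV.ampliate]

theorem exchange_posSemidef {A B C : Type*} {M : Matrix ((A × B) × C) ((A × B) × C) ℂ}
    (hM : M.PosSemidef) : (exchange M).PosSemidef :=
  hM.submatrix _

theorem traceOut_posSemidef {A R : Type*} [Fintype R] {M : Matrix (A × R) (A × R) ℂ}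
    (hM : M.PosSemidef) : (traceOut M).PosSemidef := by
  have : traceOut M = ∑ r, M.submatrix (fun a => (a, r)) (fun a => (a, r)) := by
    ext a a'
    simp [traceOut, Matrix.sum_apply]
  rw [this]
  exact posSemidef_sum _ fun r _ => hM.submatrix _

theorem trace_traceOut {A R : Type*} [Fintype A] [Fintype R] (M : Matrix (A × R) (A × R) ℂ) :
    (traceOut M).trace = M.trace := by
  simp [Matrix.trace, traceOut, Fintype.sum_prod_type]

theorem trace_exchange {A B C : Type*} [Fintype A] [Fintype B] [Fintype C]
    (M : Matrix ((A × B) × C) ((A × B) × C) ℂ) : (exchange M).trace = M.trace := by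
  simp only [Matrix.trace, exchange, diag_apply, submatrix_apply, Fintype.sum_prod_type]
  exact Finset.sum_congr rfl fun a _ => Finset.sum_comm

theorem sum_ampliate_apply {A B R : Type*} [Fintype A] [Fintype B]
    {Φ : Matrix A A ℂ →ₗ[ℂ] Matrix B B ℂ} (hΦ : ∀ M, (Φ M).trace = M.trace)
    (M : Matrix (A × R) (A × R) ℂ) (r r' : R) :
    ∑ b, ampliate Φ R M (b, r) (b, r') = ∑ a, M (a, r) (a, r') :=
  hΦ (Matrix.of fun a a' => M (a, r) (a', r'))

theorem trace_ampliate {A B R : Type*} [Fintype A] [Fintype B] [Fintype R]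
    {Φ : Matrix A A ℂ →ₗ[ℂ] Matrix B B ℂ} (hΦ : ∀ M, (Φ M).trace = M.trace)
    (M : Matrix (A × R) (A × R) ℂ) : (ampliate Φ R M).trace = M.trace := by
  simp only [Matrix.trace, diag_apply, Fintype.sum_prod_type_right]
  exact Finset.sum_congr rfl fun r _ => sum_ampliate_apply hΦ M r r

/-! ### Tensor products -/

theorem regroup_apply {n : ℕ} {A B : Type*} (M : Matrix (Fin n → A × B) (Fin n → A × B) ℂ)
    (t t' : (Fin n → A) × (Fin n → B)) :
    regroup n A B M t t' = M (fun j => (t.1 j, t.2 j)) (fun j => (t'.1 j, t'.2 j)) :=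
  rfl

theorem regroup_posSemidef {n : ℕ} {A B : Type*}
    {M : Matrix (Fin n → A × B) (Fin n → A × B) ℂ} (hM : M.PosSemidef) :
    (regroup n A B M).PosSemidef :=
  hM.submatrix (fun (t : (Fin n → A) × (Fin n → B)) j => (t.1 j, t.2 j))

theorem tensor_mul {n : ℕ} {A : Type*} [Fintype A] (M N : Fin n → Matrix A A ℂ) :
    tensor (fun j => M j * N j) = tensor M * tensor N := by
  ext a a'
  simp only [tensor, of_apply, mul_apply, Fintype.prod_sum, Finset.prod_mul_distrib]

theorem tensor_conjTranspose {n : ℕ} {A : Type*} (M : Fin n → Matrix A A ℂ) :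
    tensor (fun j => (M j)ᴴ) = (tensor M)ᴴ := by
  ext a a'
  simp [tensor]

theorem tensor_posSemidef {n : ℕ} {A : Type*} [Fintype A] {M : Fin n → Matrix A A ℂ}
    (hM : ∀ j, (M j).PosSemidef) : (tensor M).PosSemidef := by
  choose S hS using fun j => exists_eq_mul_conjTranspose (hM j)
  rw [funext hS, tensor_mul, tensor_conjTranspose]
  exact posSemidef_self_mul_conjTranspose _

theorem tensor_add {n : ℕ} {A : Type*} (M N : Fin n → Matrix A A ℂ) :
    tensor (fun j => M j + N j) = ∑ s : Finset (Fin n), tensor fun j => if j ∈ s then M j else N j := by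
  ext a a'
  simp only [tensor, of_apply, Matrix.sum_apply, Matrix.add_apply, Fintype.prod_add]
  refine Finset.sum_congr rfl fun s _ => ?_
  have : ∀ j, (if j ∈ s then M j else N j) (a j) (a' j)
      = if j ∈ s then M j (a j) (a' j) else N j (a j) (a' j) := fun j => by split_ifs <;> rfl
  simp only [this, Finset.prod_ite]
  congr 2 <;> ext <;> simp

/-- Expanding `⨂ (M + (N - M))` over subsets, the full subset contributes `⨂ M` and every other term
is positive. -/
theorem tensor_sub_posSemidef {n : ℕ} {A : Type*} [Fintype A] {M N : Fin n → Matrix A A ℂ}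
    (hM : ∀ j, (M j).PosSemidef) (hN : ∀ j, (N j - M j).PosSemidef) :
    (tensor N - tensor M).PosSemidef := by
  have h : N = fun j => M j + (N j - M j) := by ext; simp
  rw [h, tensor_add, ← Finset.add_sum_erase _ _ (Finset.mem_univ Finset.univ)]
  simp only [Finset.mem_univ, if_true, add_sub_cancel_left]
  refine posSemidef_sum _ fun s _ => tensor_posSemidef fun j => ?_
  split_ifs
  exacts [hM j, hN j]

theorem tensor_sum {n : ℕ} {A I : Type*} [Fintype I] (M : Fin n → I → Matrix A A ℂ) :
    tensor (fun j => ∑ i, M j i) = ∑ o : Fin n → I, tensor fun j => M j (o j) := by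
  ext a a'
  simp [tensor, Matrix.sum_apply, Fintype.prod_sum]

theorem tensor_smul {n : ℕ} {A : Type*} (c : Fin n → ℂ) (M : Fin n → Matrix A A ℂ) :
    tensor (fun j => c j • M j) = (∏ j, c j) • tensor M := by
  ext a a'
  simp [tensor, Finset.prod_mul_distrib]

theorem mapPow_tensor {n : ℕ} {A B : Type*} [Fintype A] [DecidableEq A]
    (Ψ : Matrix A A ℂ →ₗ[ℂ] Matrix B B ℂ) (M : Fin n → Matrix A A ℂ) :
    mapPow n Ψ (tensor M) = tensor fun j => Ψ (M j) := by
  have h : ∀ j, Ψ (M j) = ∑ a, ∑ a', M j a a' • Ψ (single a a' 1) := fun j => by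
    conv_lhs => rw [matrix_eq_sum_single (M j)]
    simp only [map_sum, ← map_smul, smul_single, smul_eq_mul, mul_one]
  ext b b'
  simp only [h, mapPow, LinearMap.coe_mk, AddHom.coe_mk, tensor, of_apply, Matrix.sum_apply,
    Matrix.smul_apply, smul_eq_mul, Fintype.prod_sum, Finset.prod_mul_distrib]

/-! ### The universal verifier -/

/-- Memories `U i` that record all messages exchanged up to the verifier's message of round `i`. -/
structure History {m : ℕ} (X Y U : Fin (m + 1) → Type) where
  first : U 0 ≃ X 0
  next : ∀ i : Fin m, U i.succ ≃ (Y i.castSucc × U i.castSucc) × X i.succ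

namespace History

variable {m : ℕ} {X Y U : Fin (m + 1) → Type}

/-- The history of `n` parallel instances. -/
def pow (E : History X Y U) (n : ℕ) :
    History (fun i => Fin n → X i) (fun i => Fin n → Y i) (fun i => Fin n → U i) where
  first := Equiv.arrowCongr (Equiv.refl _) E.first
  next i := (Equiv.arrowCongr (Equiv.refl _) (E.next i)).trans
    ((Equiv.arrowProdEquivProdArrow (Fin n) (fun _ => Y i.castSucc × U i.castSucc)
      (fun _ => X i.succ)).trans
      (Equiv.prodCongr (Equiv.arrowProdEquivProdArrow (Fin n) (fun _ => Y i.castSucc)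
        (fun _ => U i.castSucc)) (Equiv.refl _)))

variable [∀ i, DecidableEq (X i)]

/-- The vector `∑ x, |x⟩|x⟩`, as the first message of the universal verifier. -/
def initVec (E : History X Y U) (t : X 0 × U 0) : ℂ :=
  if E.first t.2 = t.1 then 1 else 0

/-- The (unnormalized) initial state of the universal verifier. -/
def init (E : History X Y U) : Matrix (X 0 × U 0) (X 0 × U 0) ℂ :=
  vecMulVec E.initVec (star E.initVec)

/-- The universal verifier records the prover's message, and sends one half of
`∑ x, |x⟩|x⟩`, keeping the other half. -/
def respond (E : History X Y U) (i : Fin m) :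
    Matrix (Y i.castSucc × U i.castSucc) (Y i.castSucc × U i.castSucc) ℂ →ₗ[ℂ]
      Matrix (X i.succ × U i.succ) (X i.succ × U i.succ) ℂ where
  toFun M := Matrix.of fun t t' =>
    if (E.next i t.2).2 = t.1 ∧ (E.next i t'.2).2 = t'.1 then
      M (E.next i t.2).1 (E.next i t'.2).1 else 0
  map_add' M N := by ext; simp only [of_apply, Matrix.add_apply]; split_ifs <;> simp
  map_smul' c M := by ext; simp only [of_apply, Matrix.smul_apply]; split_ifs <;> simp

variable [∀ i, Fintype (X i)] [∀ i, Fintype (Y i)] [∀ i, Fintype (U i)]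

/-- The joint state of the prover and the universal verifier. -/
abbrev runUniversal (E : History X Y U) (B : Strategy X Y) (i : Fin (m + 1)) :
    Matrix ((Y i × U i) × B.W i) ((Y i × U i) × B.W i) ℂ :=
  run E.init E.respond B i

/-- The Choi operator of the first rounds of a strategy. -/
def comb (E : History X Y U) (B : Strategy X Y) (i : Fin (m + 1)) :
    Matrix (Y i × U i) (Y i × U i) ℂ :=
  traceOut (E.runUniversal B i)

/-- The constraints on the Choi operators of the prover's strategies. -/
structure IsComb (E : History X Y U) [∀ i, DecidableEq (U i)]
    (R : ∀ i, Matrix (Y i × U i) (Y i × U i) ℂ) : Prop where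
  posSemidef : ∀ i, (R i).PosSemidef
  first : ∀ u u', ∑ y, R 0 (y, u) (y, u') = if u = u' then 1 else 0
  next : ∀ (i : Fin m) u u', ∑ y, R i.succ (y, u) (y, u') =
    if (E.next i u).2 = (E.next i u').2 then R i.castSucc (E.next i u).1 (E.next i u').1 else 0

theorem respond_completelyPositive (E : History X Y U) (i : Fin m) :
    IsCompletelyPositive (E.respond i) := by
  intro d M hM
  classical
  -- The response has a single Kraus operator; `K` is its tensor product with the identity on `ℂ^d`.
  let K : Matrix ((X i.succ × U i.succ) × Fin d) ((Y i.castSucc × U i.castSucc) × Fin d) ℂ :=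
    Matrix.of fun t s => if (E.next i t.1.2).2 = t.1.1 ∧ s = ((E.next i t.1.2).1, t.2) then 1 else 0
  convert hM.mul_mul_conjTranspose_same K using 1
  ext t t'
  simp only [mul_apply, conjTranspose_apply, K, of_apply, ampliate, respond, LinearMap.coe_mk,
    AddHom.coe_mk, ite_and, apply_ite star, star_one, star_zero, mul_ite, ite_mul,
    one_mul, zero_mul, mul_one, mul_zero, Finset.sum_ite_irrel, Finset.sum_ite_eq',
    Finset.sum_const_zero, Finset.mem_univ, if_true]
  split_ifs <;> rfl

end History

/-- The state of a run stays positive if it is prepared positive and evolves completely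
positively. -/
theorem run_posSemidef {m : ℕ} {X Y Z : Fin (m + 1) → Type} [∀ i, Fintype (X i)]
    [∀ i, Fintype (Y i)] [∀ i, Fintype (Z i)]
    {ρ : Matrix (X 0 × Z 0) (X 0 × Z 0) ℂ}
    {Ψ : ∀ i : Fin m, Matrix (Y i.castSucc × Z i.castSucc) (Y i.castSucc × Z i.castSucc) ℂ →ₗ[ℂ]
      Matrix (X i.succ × Z i.succ) (X i.succ × Z i.succ) ℂ}
    (hρ : ρ.PosSemidef) (hΨ : ∀ i, IsCompletelyPositive (Ψ i))
    (B : Strategy X Y) (i : Fin (m + 1)) : (run ρ Ψ B i).PosSemidef := by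
  induction i using Fin.induction with
  | zero =>
    exact exchange_posSemidef
      (IsCompletelyPositive.ampliate B.isChannel_first.completelyPositive hρ)
  | succ i ih =>
    exact exchange_posSemidef
      (IsCompletelyPositive.ampliate (B.isChannel_next i).completelyPositive
        (exchange_posSemidef ((hΨ i).ampliate ih)))

theorem run_succ {m : ℕ} {X Y Z : Fin (m + 1) → Type} [∀ i, Fintype (X i)]
    [∀ i, Fintype (Y i)] (ρ : Matrix (X 0 × Z 0) (X 0 × Z 0) ℂ)
    (Ψ : ∀ i : Fin m, Matrix (Y i.castSucc × Z i.castSucc) (Y i.castSucc × Z i.castSucc) ℂ →ₗ[ℂ]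
      Matrix (X i.succ × Z i.succ) (X i.succ × Z i.succ) ℂ)
    (B : Strategy X Y) (i : Fin m) :
    run ρ Ψ B i.succ = exchange (ampliate (B.next i) (Z i.succ)
      (exchange (ampliate (Ψ i) (B.W i.castSucc) (run ρ Ψ B i.castSucc)))) :=
  rfl

/-- The trace of the joint state is preserved. -/
theorem trace_run {m : ℕ} {X Y Z : Fin (m + 1) → Type} [∀ i, Fintype (X i)]
    [∀ i, Fintype (Y i)] [∀ i, Fintype (Z i)]
    {ρ : Matrix (X 0 × Z 0) (X 0 × Z 0) ℂ}
    {Ψ : ∀ i : Fin m, Matrix (Y i.castSucc × Z i.castSucc) (Y i.castSucc × Z i.castSucc) ℂ →ₗ[ℂ]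
      Matrix (X i.succ × Z i.succ) (X i.succ × Z i.succ) ℂ}
    (hΨ : ∀ i M, (Ψ i M).trace = M.trace)
    (B : Strategy X Y) (i : Fin (m + 1)) : (run ρ Ψ B i).trace = ρ.trace := by
  induction i using Fin.induction with
  | zero => exact (trace_exchange _).trans (trace_ampliate B.isChannel_first.tracePreserving ρ)
  | succ i ih =>
    rw [run_succ, trace_exchange, trace_ampliate (B.isChannel_next i).tracePreserving,
      trace_exchange, trace_ampliate (hΨ i), ih]

namespace History

variable {m : ℕ} {X Y U : Fin (m + 1) → Type} [∀ i, DecidableEq (X i)]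
  [∀ i, Fintype (X i)] [∀ i, Fintype (Y i)] [∀ i, Fintype (U i)]

/-- Tracing out the prover's whole output cancels his last channel. What remains is the stored half
of `∑ x, |x⟩|x⟩`, which contributes an identity on `X`, next to the previous Choi operator. -/
theorem isComb_comb (E : History X Y U) [∀ i, DecidableEq (U i)] (B : Strategy X Y) :
    E.IsComb (E.comb B) where
  posSemidef i := traceOut_posSemidef
    (run_posSemidef (posSemidef_vecMulVec_self_star _) E.respond_completelyPositive B i)
  first u u' := by
    have h := sum_ampliate_apply B.isChannel_first.tracePreserving E.init u u'
    rw [Fintype.sum_prod_type] at h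
    refine Eq.trans h ?_
    simp [init, initVec, vecMulVec_apply]
  next i u u' := by
    have h := sum_ampliate_apply (B.isChannel_next i).tracePreserving
      (exchange (ampliate (E.respond i) (B.W i.castSucc) (E.runUniversal B i.castSucc))) u u'
    rw [Fintype.sum_prod_type, Fintype.sum_prod_type] at h
    refine Eq.trans h ?_
    simp only [exchange, submatrix_apply, ampliate, respond, LinearMap.coe_mk, AddHom.coe_mk,
      of_apply, ite_and, Finset.sum_ite_irrel, Finset.sum_const_zero, Finset.sum_ite_eq,
      Finset.mem_univ, if_true, eq_comm (b := (E.next i u).2)]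
    rfl

end History

namespace History

variable {m : ℕ} {X Y Z U : Fin (m + 1) → Type}

/-! ### Simulation of a verifier by the universal verifier -/

section

variable [∀ i, DecidableEq (Y i)]

/-- The operator `|y⟩⟨y'| ⊗ N`. -/
def unitTensor {A B : Type*} [DecidableEq A] (y y' : A) (N : Matrix B B ℂ) :
    Matrix (A × B) (A × B) ℂ :=
  Matrix.of fun a b => if y = a.1 ∧ y' = b.1 then N a.2 b.2 else 0

/-- The operator `sim ρ Ψ i u u'` on the memory of the verifier given by `ρ` and `Ψ` corresponds
to the operator `|u⟩⟨u'|` on the memory of the universal verifier. -/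
def sim (E : History X Y U) (ρ : Matrix (X 0 × Z 0) (X 0 × Z 0) ℂ)
    (Ψ : ∀ i : Fin m, Matrix (Y i.castSucc × Z i.castSucc) (Y i.castSucc × Z i.castSucc) ℂ →ₗ[ℂ]
      Matrix (X i.succ × Z i.succ) (X i.succ × Z i.succ) ℂ) (i : Fin (m + 1)) :
    U i → U i → Matrix (Z i) (Z i) ℂ :=
  Fin.induction (motive := fun i => U i → U i → Matrix (Z i) (Z i) ℂ)
    (fun u u' => Matrix.of fun z z' => ρ (E.first u, z) (E.first u', z'))
    (fun i τ u u' => Matrix.of fun z z' =>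
      Ψ i (unitTensor (E.next i u).1.1 (E.next i u').1.1 (τ (E.next i u).1.2 (E.next i u').1.2))
        ((E.next i u).2, z) ((E.next i u').2, z'))
    i

variable {ρ : Matrix (X 0 × Z 0) (X 0 × Z 0) ℂ}
  {Ψ : ∀ i : Fin m, Matrix (Y i.castSucc × Z i.castSucc) (Y i.castSucc × Z i.castSucc) ℂ →ₗ[ℂ]
    Matrix (X i.succ × Z i.succ) (X i.succ × Z i.succ) ℂ}

theorem sim_succ (E : History X Y U) (i : Fin m) (u u' : U i.succ) (z z' : Z i.succ) :
    E.sim ρ Ψ i.succ u u' z z' = Ψ i (unitTensor (E.next i u).1.1 (E.next i u').1.1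
      (E.sim ρ Ψ i.castSucc (E.next i u).1.2 (E.next i u').1.2))
        ((E.next i u).2, z) ((E.next i u').2, z') :=
  rfl

/-- Replacement of the universal memory by a memory `Z`, for a family `τ` of operators on `Z`. -/
def contract {A V C R : Type*} [Fintype V] (τ : V → V → Matrix C C ℂ)
    (M : Matrix ((A × V) × R) ((A × V) × R) ℂ) : Matrix ((A × C) × R) ((A × C) × R) ℂ :=
  Matrix.of fun t t' => ∑ u, ∑ u', τ u u' t.1.2 t'.1.2 *
    M ((t.1.1, u), t.2) ((t'.1.1, u'), t'.2)

/-- Replacement of the universal memory commutes with the operations of the prover. -/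
theorem exchange_ampliate_contract {A B V C R S : Type*} [Fintype V]
    (Φ : Matrix (A × R) (A × R) ℂ →ₗ[ℂ] Matrix (B × S) (B × S) ℂ)
    (τ : V → V → Matrix C C ℂ) (M : Matrix ((A × V) × R) ((A × V) × R) ℂ) :
    exchange (ampliate Φ C (exchange (contract τ M)))
      = contract τ (exchange (ampliate Φ V (exchange M))) := by
  ext t t'
  simp only [exchange, ampliate, contract, submatrix_apply, of_apply]
  have h : (Matrix.of fun a a' : A × R => ∑ u, ∑ u', τ u u' t.1.2 t'.1.2 *
      M ((a.1, u), a.2) ((a'.1, u'), a'.2)) = ∑ u, ∑ u', τ u u' t.1.2 t'.1.2 •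
        Matrix.of fun a a' : A × R => M ((a.1, u), a.2) ((a'.1, u'), a'.2) := by
    ext a a'
    simp [Matrix.sum_apply]
  rw [h]
  simp only [map_sum, map_smul, Matrix.sum_apply, Matrix.smul_apply, smul_eq_mul]

variable [∀ i, DecidableEq (X i)] [∀ i, Fintype (X i)] [∀ i, Fintype (Y i)] [∀ i, Fintype (U i)]

/-- Replacement of the universal memory intertwines the responses of the verifiers. -/
theorem ampliate_contract (E : History X Y U) (i : Fin m) {R : Type*}
    (M : Matrix ((Y i.castSucc × U i.castSucc) × R) ((Y i.castSucc × U i.castSucc) × R) ℂ) :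
    ampliate (Ψ i) R (contract (E.sim ρ Ψ i.castSucc) M)
      = contract (E.sim ρ Ψ i.succ) (ampliate (E.respond i) R M) := by
  ext ⟨⟨x, z⟩, w⟩ ⟨⟨x', z'⟩, w'⟩
  simp only [ampliate, contract, of_apply, respond, LinearMap.coe_mk, AddHom.coe_mk]
  -- Expansion into `|y⟩⟨y'| ⊗ τ`, on which `sim` prescribes the value of `Ψ i`; linearity does the
  -- rest.
  have h : (Matrix.of fun a a' : Y i.castSucc × Z i.castSucc =>
      ∑ u, ∑ u', E.sim ρ Ψ i.castSucc u u' a.2 a'.2 * M ((a.1, u), w) ((a'.1, u'), w'))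
      = ∑ s : Y i.castSucc × U i.castSucc, ∑ s' : Y i.castSucc × U i.castSucc,
        M (s, w) (s', w') • unitTensor s.1 s'.1 (E.sim ρ Ψ i.castSucc s.2 s'.2) := by
    ext a a'
    simp only [Matrix.sum_apply, Matrix.smul_apply, unitTensor, of_apply, smul_eq_mul, mul_ite,
      mul_zero, Fintype.sum_prod_type, ite_and, Finset.sum_ite_irrel, Finset.sum_const_zero]
    rw [Finset.sum_eq_single a.1 (by simp +contextual) (by simp)]
    simp [mul_comm]
  rw [h, ← (E.next i).symm.sum_comp]
  simp only [← (E.next i).symm.sum_comp (fun u' => _ * _)]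
  simp only [map_sum, map_smul, Matrix.sum_apply, Matrix.smul_apply, sim_succ,
    Equiv.apply_symm_apply, smul_eq_mul, mul_ite, mul_zero]
  simp [Fintype.sum_prod_type_right, ite_and, mul_comm]

/-- The prover never touches the verifier's memory, so the substitution of memories can be postponed
to the end. -/
theorem run_eq_contract (E : History X Y U) (B : Strategy X Y) (i : Fin (m + 1)) :
    run ρ Ψ B i = contract (E.sim ρ Ψ i) (E.runUniversal B i) := by
  induction i using Fin.induction with
  | zero =>
    ext ⟨⟨y, z⟩, w⟩ ⟨⟨y', z'⟩, w'⟩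
    change B.first (Matrix.of fun a a' => ρ (a, z) (a', z')) (y, w) (y', w') =
      ∑ u, ∑ u', ρ (E.first u, z) (E.first u', z') *
        B.first (Matrix.of fun a a' => E.init (a, u) (a', u')) (y, w) (y', w')
    have h : (Matrix.of fun a a' => ρ (a, z) (a', z')) = ∑ u, ∑ u',
        ρ (E.first u, z) (E.first u', z') • Matrix.of fun a a' => E.init (a, u) (a', u') := by
      ext a a'
      simp only [Matrix.sum_apply, Matrix.smul_apply, of_apply, init, initVec, vecMulVec_apply,
        Pi.star_apply, apply_ite star, star_one, star_zero, smul_eq_mul]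
      rw [← E.first.symm.sum_comp]
      simp only [← E.first.symm.sum_comp (fun u' => _ * _)]
      simp
    rw [h]
    simp only [map_sum, map_smul, Matrix.sum_apply, Matrix.smul_apply, smul_eq_mul]
  | succ i ih =>
    rw [run_succ, ih, ampliate_contract, exchange_ampliate_contract]
    rfl

/-- The measurement operator of the universal verifier that corresponds to `Q`. -/
def pullback {A V C : Type*} [Fintype C] (τ : V → V → Matrix C C ℂ)
    (Q : Matrix (A × C) (A × C) ℂ) : Matrix (A × V) (A × V) ℂ :=
  Matrix.of fun t t' => ∑ z, ∑ z', Q (t.1, z) (t'.1, z') * τ t'.2 t.2 z' z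

theorem traceOut_contract {A V C R : Type*} [Fintype V] [Fintype R] (τ : V → V → Matrix C C ℂ)
    (M : Matrix ((A × V) × R) ((A × V) × R) ℂ) :
    traceOut (contract τ M) = Matrix.of fun t t' => ∑ u, ∑ u', τ u u' t.2 t'.2 *
      traceOut M (t.1, u) (t'.1, u') := by
  ext t t'
  simp only [traceOut, contract, of_apply, Finset.mul_sum]
  rw [Finset.sum_comm]
  exact Finset.sum_congr rfl fun u _ => Finset.sum_comm

theorem sum_comm_pairs {A B C D N : Type*} [Fintype A] [Fintype B] [Fintype C] [Fintype D]
    [AddCommMonoid N] (f : A → B → C → D → N) :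
    ∑ a, ∑ b, ∑ c, ∑ d, f a b c d = ∑ d, ∑ c, ∑ a, ∑ b, f a b c d := by
  calc _ = ∑ s : A × B, ∑ t : C × D, f s.1 s.2 t.1 t.2 := by simp only [Fintype.sum_prod_type]
    _ = ∑ t : C × D, ∑ s : A × B, f s.1 s.2 t.1 t.2 := Finset.sum_comm
    _ = ∑ c, ∑ d, ∑ a, ∑ b, f a b c d := by simp only [Fintype.sum_prod_type]
    _ = _ := Finset.sum_comm

/-- `pullback` is the adjoint of `contract` for the trace pairing, which explains the swapped
indices of `τ` in it. -/
theorem bornProb_run [∀ i, Fintype (Z i)] (E : History X Y U) (B : Strategy X Y)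
    (i : Fin (m + 1)) (Q : Matrix (Y i × Z i) (Y i × Z i) ℂ) :
    bornProb Q (traceOut (run ρ Ψ B i)) = bornProb (pullback (E.sim ρ Ψ i) Q) (E.comb B i) := by
  rw [run_eq_contract E, bornProb, bornProb, comb]
  congr 1
  rw [traceOut_contract]
  simp only [Matrix.trace, diag_apply, mul_apply, pullback, of_apply,
    Fintype.sum_prod_type, Finset.mul_sum, Finset.sum_mul]
  refine Finset.sum_congr rfl fun y _ => ?_
  rw [Finset.sum_comm, Finset.sum_comm (s := (Finset.univ : Finset (U i)))]
  refine Finset.sum_congr rfl fun y' _ => ?_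
  rw [sum_comm_pairs]
  simp only [mul_assoc]

end

end History

/-! ### Parallel instances and positivity of the simulated measurement. -/

namespace History

variable {m : ℕ} {X Y Z U : Fin (m + 1) → Type} [∀ i, DecidableEq (Y i)] [∀ i, DecidableEq (Z i)]
  [∀ i, Fintype (Y i)] [∀ i, Fintype (Z i)]
  {ρ : Matrix (X 0 × Z 0) (X 0 × Z 0) ℂ}
  {Ψ : ∀ i : Fin m, Matrix (Y i.castSucc × Z i.castSucc) (Y i.castSucc × Z i.castSucc) ℂ →ₗ[ℂ]
    Matrix (X i.succ × Z i.succ) (X i.succ × Z i.succ) ℂ}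

theorem unitTensor_tensor {n : ℕ} {A B : Type*} [DecidableEq A] (y y' : Fin n → A)
    (N : Fin n → Matrix B B ℂ) :
    unitTensor y y' (tensor N) = regroup n A B (tensor fun j => unitTensor (y j) (y' j) (N j)) := by
  ext t t'
  simp only [unitTensor, regroup_apply, tensor, of_apply, Fintype.prod_ite_zero, funext_iff,
    forall_and]

/-- Matrix units of a tensor power are products, and tensor powers of maps send products to
products, so the recursion splits over the instances. -/
theorem sim_pow (E : History X Y U) (n : ℕ) (i : Fin (m + 1)) (u u' : Fin n → U i) :
    (E.pow n).sim (Z := fun i => Fin n → Z i) (regroup n (X 0) (Z 0) (tensor fun _ => ρ))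
      (fun i => (regroup n (X i.succ) (Z i.succ)).toLinearMap ∘ₗ mapPow n (Ψ i) ∘ₗ
        (regroup n (Y i.castSucc) (Z i.castSucc)).symm.toLinearMap) i u u' =
      tensor fun j => E.sim ρ Ψ i (u j) (u' j) := by
  induction i using Fin.induction with
  | zero => rfl
  | succ i ih =>
    ext z z'
    rw [sim_succ, ih, unitTensor_tensor]
    simp only [LinearMap.comp_apply, LinearEquiv.coe_coe, LinearEquiv.symm_apply_apply,
      mapPow_tensor, regroup_apply]
    rfl

theorem pullback_tensor {n : ℕ} {A V C : Type*} [Fintype C] (τ : V → V → Matrix C C ℂ)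
    (Q : Fin n → Matrix (A × C) (A × C) ℂ) :
    pullback (fun u u' : Fin n → V => tensor fun j => τ (u j) (u' j)) (regroup n A C (tensor Q))
      = regroup n A V (tensor fun j => pullback τ (Q j)) := by
  ext t t'
  simp only [pullback, regroup_apply, tensor, of_apply, Fintype.prod_sum, Finset.prod_mul_distrib]

/-- The operators `τ u u'` as blocks of one operator. -/
def blocks {V C : Type*} (τ : V → V → Matrix C C ℂ) : Matrix (V × C) (V × C) ℂ :=
  Matrix.of fun t t' => τ t.1 t'.1 t.2 t'.2

theorem blocks_sim_posSemidef [∀ i, Fintype (X i)] [∀ i, Fintype (U i)] (E : History X Y U)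
    (hρ : ρ.PosSemidef) (hΨ : ∀ i, IsCompletelyPositive (Ψ i)) (i : Fin (m + 1)) :
    (blocks (E.sim ρ Ψ i)).PosSemidef := by
  induction i using Fin.induction with
  | zero => exact hρ.submatrix fun t : U 0 × Z 0 => (E.first t.1, t.2)
  | succ i ih =>
    classical
    -- `K` sends `|u, z⟩` to `∑ y, |y, z⟩|y, u⟩`. Conjugation by it turns the blocks `τ u u'` into
    -- the blocks `|y⟩⟨y'| ⊗ τ u u'`.
    let K : Matrix ((Y i.castSucc × Z i.castSucc) × (Y i.castSucc × U i.castSucc))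
        (U i.castSucc × Z i.castSucc) ℂ :=
      Matrix.of fun t s => if t.2.1 = t.1.1 ∧ s = (t.2.2, t.1.2) then 1 else 0
    have h := ((hΨ i).ampliate (ih.mul_mul_conjTranspose_same K)).submatrix
      fun t : U i.succ × Z i.succ => (((E.next i t.1).2, t.2), (E.next i t.1).1)
    convert h using 1
    ext t t'
    simp only [blocks, sim_succ, of_apply, submatrix_apply, ampliate]
    refine congrFun (congrFun (congrArg (Ψ i) ?_) _) _
    ext a a'
    simp only [mul_apply, conjTranspose_apply, K, of_apply, unitTensor, ite_and,
      apply_ite star, star_one, star_zero, mul_ite, ite_mul, one_mul, zero_mul, mul_one, mul_zero,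
      Finset.sum_ite_irrel, Finset.sum_ite_eq', Finset.sum_const_zero, Finset.mem_univ, if_true]
    split_ifs <;> rfl

/-- In a factorization `S Sᴴ` of the block operator, each column of `S` gives one Kraus operator of
`pullback τ`. -/
theorem pullback_posSemidef {A V C : Type*} [Fintype A] [Fintype V] [Fintype C]
    {τ : V → V → Matrix C C ℂ} (hτ : (blocks τ).PosSemidef) {Q : Matrix (A × C) (A × C) ℂ}
    (hQ : Q.PosSemidef) : (pullback τ Q).PosSemidef := by
  classical
  obtain ⟨S, hS⟩ := exists_eq_mul_conjTranspose hτ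
  let K (k : V × C) : Matrix (A × V) (A × C) ℂ :=
    Matrix.of fun t s => if t.1 = s.1 then star (S (t.2, s.2) k) else 0
  have h : pullback τ Q = ∑ k, K k * Q * (K k)ᴴ := by
    ext t t'
    have hτ' : ∀ u u' z z', τ u u' z z' = ∑ k, S (u, z) k * star (S (u', z') k) := fun u u' z z' =>
      congr_fun (congr_fun hS (u, z)) (u', z')
    simp only [pullback, hτ', of_apply, Matrix.sum_apply, mul_apply, K, conjTranspose_apply,
      Fintype.sum_prod_type (α₁ := A), ite_mul, mul_ite, zero_mul, mul_zero,
      apply_ite star, star_star, star_zero, Finset.sum_ite_irrel, Finset.sum_const_zero,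
      Finset.sum_ite_eq, Finset.mem_univ, if_true, Finset.mul_sum, Finset.sum_mul]
    rw [Finset.sum_comm]
    simp only [Finset.sum_comm (s := (Finset.univ : Finset C))
      (t := (Finset.univ : Finset (V × C)))]
    refine Finset.sum_congr rfl fun k _ => Finset.sum_congr rfl fun z _ =>
      Finset.sum_congr rfl fun z' _ => ?_
    ring
  rw [h]
  exact posSemidef_sum _ fun k _ => hQ.mul_mul_conjTranspose_same (K k)

end History

/-! ### Operations of the semidefinite program and their adjoints. -/

/-- The operator `1 ⊗ A`. -/
def idTensor (Y : Type*) {V : Type*} [DecidableEq Y] (A : Matrix V V ℂ) :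
    Matrix (Y × V) (Y × V) ℂ :=
  Matrix.of fun t t' => if t.1 = t'.1 then A t.2 t'.2 else 0

/-- Partial trace over the first tensor factor. -/
def traceLeft {Y V : Type*} [Fintype Y] (M : Matrix (Y × V) (Y × V) ℂ) : Matrix V V ℂ :=
  Matrix.of fun u u' => ∑ y, M (y, u) (y, u')

/-- Partial trace over the second tensor factor, for a space that is identified with a tensor
product. -/
def blockTrace {V H X : Type*} [Fintype X] (e : V ≃ H × X) (A : Matrix V V ℂ) : Matrix H H ℂ :=
  Matrix.of fun h h' => ∑ x, A (e.symm (h, x)) (e.symm (h', x))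

/-- The operator `N ⊗ 1`, for a space that is identified with a tensor product. -/
def tensorId {V H X : Type*} [DecidableEq X] (e : V ≃ H × X) (N : Matrix H H ℂ) : Matrix V V ℂ :=
  Matrix.of fun u u' => if (e u).2 = (e u').2 then N (e u).1 (e u').1 else 0

/-- This adjointness, with that of `blockTrace` and `tensorId`, turns the constraints on Choi
operators into those on certificates. -/
theorem trace_idTensor_mul {Y V : Type*} [Fintype Y] [DecidableEq Y] [Fintype V]
    (A : Matrix V V ℂ) (M : Matrix (Y × V) (Y × V) ℂ) :
    (idTensor Y A * M).trace = (A * traceLeft M).trace := by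
  simp only [Matrix.trace, diag_apply, mul_apply, idTensor, traceLeft, of_apply,
    Fintype.sum_prod_type, ite_mul, zero_mul, Finset.sum_ite_irrel, Finset.sum_const_zero,
    Finset.sum_ite_eq, Finset.mem_univ, if_true, Finset.mul_sum]
  rw [Finset.sum_comm]
  exact Finset.sum_congr rfl fun u _ => Finset.sum_comm

theorem trace_mul_tensorId {V H X : Type*} [Fintype V] [Fintype H] [Fintype X] [DecidableEq X]
    (e : V ≃ H × X) (A : Matrix V V ℂ) (N : Matrix H H ℂ) :
    (A * tensorId e N).trace = (blockTrace e A * N).trace := by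
  simp only [Matrix.trace, diag_apply, mul_apply, tensorId, blockTrace, of_apply]
  rw [← e.symm.sum_comp]
  refine (Finset.sum_congr rfl fun u _ => (e.symm.sum_comp _).symm).trans ?_
  simp only [Equiv.apply_symm_apply,
    Fintype.sum_prod_type, mul_ite, mul_zero, Finset.sum_ite_eq', Finset.mem_univ, if_true,
    Finset.sum_mul]
  exact Finset.sum_congr rfl fun h _ => Finset.sum_comm

theorem posSemidef_of_idTensor {Y V : Type*} [DecidableEq Y] [Nonempty Y]
    {A : Matrix V V ℂ} (h : (idTensor Y A).PosSemidef) : A.PosSemidef := by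
  convert h.submatrix (fun u => (Classical.arbitrary Y, u)) using 1
  ext u u'
  simp [idTensor]

theorem blockTrace_posSemidef {V H X : Type*} [Fintype X] (e : V ≃ H × X) {A : Matrix V V ℂ}
    (hA : A.PosSemidef) : (blockTrace e A).PosSemidef := by
  have : blockTrace e A = ∑ x, A.submatrix (fun h => e.symm (h, x)) (fun h => e.symm (h, x)) := by
    ext h h'
    simp [blockTrace, Matrix.sum_apply]
  rw [this]
  exact posSemidef_sum _ fun x _ => hA.submatrix _

theorem idTensor_add {Y V : Type*} [DecidableEq Y] (A B : Matrix V V ℂ) :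
    idTensor Y (A + B) = idTensor Y A + idTensor Y B := by
  ext; simp [idTensor, ite_add_ite]

theorem idTensor_smul {Y V : Type*} [DecidableEq Y] (c : ℝ) (A : Matrix V V ℂ) :
    idTensor Y (c • A) = c • idTensor Y A := by
  ext; simp [idTensor]

theorem blockTrace_add {V H X : Type*} [Fintype X] (e : V ≃ H × X) (A B : Matrix V V ℂ) :
    blockTrace e (A + B) = blockTrace e A + blockTrace e B := by
  ext; simp [blockTrace, Finset.sum_add_distrib]

theorem blockTrace_smul {V H X : Type*} [Fintype X] (e : V ≃ H × X) (c : ℝ) (A : Matrix V V ℂ) :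
    blockTrace e (c • A) = c • blockTrace e A := by
  ext; simp [blockTrace, Finset.mul_sum]

theorem idTensor_tensor {n : ℕ} {Y V : Type*} [DecidableEq Y] (A : Fin n → Matrix V V ℂ) :
    idTensor (Fin n → Y) (tensor A) = regroup n Y V (tensor fun j => idTensor Y (A j)) := by
  ext t t'
  simp only [idTensor, regroup_apply, tensor, of_apply, Fintype.prod_ite_zero, funext_iff]

theorem trace_tensor {n : ℕ} {V : Type*} [Fintype V] (A : Fin n → Matrix V V ℂ) :
    (tensor A).trace = ∏ j, (A j).trace := by
  simp [Matrix.trace, tensor, Fintype.prod_sum]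

theorem smul_posSemidef {V : Type*} {A : Matrix V V ℂ} (hA : A.PosSemidef) {c : ℝ} (hc : 0 ≤ c) :
    (c • A).PosSemidef :=
  hA.smul hc

namespace History

variable {m : ℕ} {X Y U : Fin (m + 1) → Type} [∀ i, Fintype (X i)] [∀ i, Fintype (U i)]
  [∀ i, DecidableEq (Y i)]

/-! ### Dual certificates -/

/-- `E.Cert i C` is the dual certificate for the bound `1` on the probability of the outcome `C`,
measured by the universal verifier after round `i`. -/
def Cert (E : History X Y U) (i : Fin (m + 1)) : Matrix (Y i × U i) (Y i × U i) ℂ → Prop :=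
  Fin.induction (motive := fun i => Matrix (Y i × U i) (Y i × U i) ℂ → Prop)
    (fun C => ∃ A, (idTensor (Y 0) A - C).PosSemidef ∧ A.trace.re ≤ 1)
    (fun i P C => ∃ A, (idTensor (Y i.succ) A - C).PosSemidef ∧ P (blockTrace (E.next i) A))
    i

variable {E : History X Y U}

theorem cert_zero_iff {C : Matrix (Y 0 × U 0) (Y 0 × U 0) ℂ} :
    E.Cert 0 C ↔ ∃ A, (idTensor (Y 0) A - C).PosSemidef ∧ A.trace.re ≤ 1 :=
  Iff.rfl

theorem cert_succ_iff {i : Fin m} {C : Matrix (Y i.succ × U i.succ) (Y i.succ × U i.succ) ℂ} :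
    E.Cert i.succ C ↔ ∃ A, (idTensor (Y i.succ) A - C).PosSemidef ∧
      E.Cert i.castSucc (blockTrace (E.next i) A) :=
  Iff.rfl

theorem Cert.mono {i : Fin (m + 1)} {C C' : Matrix (Y i × U i) (Y i × U i) ℂ} (hC : E.Cert i C)
    (h : (C - C').PosSemidef) : E.Cert i C' := by
  induction i using Fin.cases with
  | zero =>
    obtain ⟨A, h1, h2⟩ := cert_zero_iff.1 hC
    exact cert_zero_iff.2 ⟨A, by simpa using h1.add h, h2⟩
  | succ i =>
    obtain ⟨A, h1, h2⟩ := cert_succ_iff.1 hC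
    exact cert_succ_iff.2 ⟨A, by simpa using h1.add h, h2⟩

theorem convex_cert (E : History X Y U) (i : Fin (m + 1)) : Convex ℝ {C | E.Cert i C} := by
  have key {Y' U' : Type} [DecidableEq Y'] {A B : Matrix U' U' ℂ}
      {C D : Matrix (Y' × U') (Y' × U') ℂ} (hA : (idTensor Y' A - C).PosSemidef)
      (hB : (idTensor Y' B - D).PosSemidef) {a b : ℝ} (ha : 0 ≤ a) (hb : 0 ≤ b) :
      (idTensor Y' (a • A + b • B) - (a • C + b • D)).PosSemidef := by
    have := (smul_posSemidef hA ha).add (smul_posSemidef hB hb)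
    rw [smul_sub, smul_sub] at this
    rwa [idTensor_add, idTensor_smul, idTensor_smul, add_sub_add_comm]
  induction i using Fin.induction with
  | zero =>
    rintro C ⟨A, hA, hA'⟩ D ⟨B, hB, hB'⟩ a b ha hb hab
    refine ⟨a • A + b • B, key hA hB ha hb, ?_⟩
    simp only [trace_add, trace_smul, Complex.add_re, Complex.real_smul, Complex.re_ofReal_mul]
    nlinarith
  | succ i ih =>
    rintro C ⟨A, hA, hA'⟩ D ⟨B, hB, hB'⟩ a b ha hb hab
    refine ⟨a • A + b • B, key hA hB ha hb, ?_⟩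
    rw [blockTrace_add, blockTrace_smul, blockTrace_smul]
    exact ih hA' hB' ha hb hab

/-- This provides the interior point needed for the separation argument. -/
theorem exists_cert_smul_one (E : History X Y U) [∀ i, DecidableEq (U i)] (i : Fin (m + 1)) :
    ∃ s : ℝ, 0 < s ∧ E.Cert i (s • 1) := by
  have key {Y' U' : Type} [DecidableEq Y'] [DecidableEq U'] (s : ℝ) :
      (idTensor Y' (s • (1 : Matrix U' U' ℂ)) - s • 1).PosSemidef := by
    have : idTensor Y' (1 : Matrix U' U' ℂ) = 1 := by
      ext t t'
      simp [idTensor, one_apply, Prod.ext_iff, ite_and]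
    rw [idTensor_smul, this, sub_self]
    exact PosSemidef.zero
  induction i using Fin.induction with
  | zero =>
    -- The `+ 1` keeps the denominator nonzero for an empty index type.
    refine ⟨1 / (Fintype.card (U 0) + 1), by positivity, _, key _, ?_⟩
    simp only [trace_smul, trace_one, Complex.real_smul, Complex.re_ofReal_mul, Complex.natCast_re]
    rw [div_mul_eq_mul_div, div_le_one (by positivity)]
    linarith
  | succ i ih =>
    obtain ⟨s, hs, hc⟩ := ih
    refine ⟨s / (Fintype.card (X i.succ) + 1), by positivity, _, key _, hc.mono ?_⟩
    have : blockTrace (E.next i) (1 : Matrix (U i.succ) (U i.succ) ℂ)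
        = (Fintype.card (X i.succ) : ℝ) • 1 := by
      ext h h'
      simp [blockTrace, one_apply]
    rw [blockTrace_smul, this, smul_smul, ← sub_smul]
    refine smul_posSemidef PosSemidef.one ?_
    rw [div_mul_eq_mul_div, sub_nonneg, div_le_iff₀ (by positivity)]
    nlinarith

variable [∀ i, Fintype (Y i)]

/-- Weak duality. -/
theorem Cert.trace_mul_le [∀ i, DecidableEq (X i)] [∀ i, DecidableEq (U i)]
    {R : ∀ i, Matrix (Y i × U i) (Y i × U i) ℂ}
    (hR : E.IsComb R) {i : Fin (m + 1)} {C : Matrix (Y i × U i) (Y i × U i) ℂ}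
    (hC : E.Cert i C) : (C * R i).trace.re ≤ 1 := by
  induction i using Fin.induction with
  | zero =>
    obtain ⟨A, h1, h2⟩ := cert_zero_iff.1 hC
    refine (trace_mul_re_mono h1 (hR.posSemidef 0)).trans ?_
    have : traceLeft (R 0) = 1 := by
      ext u u'
      simp [traceLeft, hR.first, one_apply]
    rwa [trace_idTensor_mul, this, mul_one]
  | succ i ih =>
    obtain ⟨A, h1, h2⟩ := cert_succ_iff.1 hC
    refine (trace_mul_re_mono h1 (hR.posSemidef i.succ)).trans ?_
    have : traceLeft (R i.succ) = tensorId (E.next i) (R i.castSucc) := by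
      ext u u'
      simp [traceLeft, hR.next, tensorId]
    rw [trace_idTensor_mul, this, trace_mul_tensorId]
    exact ih h2

/-- Tensor powers of dual certificates are dual certificates. -/
theorem Cert.pow [∀ i, Nonempty (Y i)] {i : Fin (m + 1)} {C : Matrix (Y i × U i) (Y i × U i) ℂ}
    (hC : E.Cert i C) (hC' : C.PosSemidef) (n : ℕ) :
    (E.pow n).Cert i (regroup n (Y i) (U i) (tensor fun _ => C)) := by
  -- Positivity of `C` is essential: it forces `A` to be positive, and only between positive
  -- operators is the tensor power monotone.
  have key {Y' U' : Type} [Fintype Y'] [Nonempty Y'] [DecidableEq Y'] [Fintype U']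
      {A : Matrix U' U' ℂ} {C : Matrix (Y' × U') (Y' × U') ℂ}
      (hA : (idTensor Y' A - C).PosSemidef) (hC : C.PosSemidef) :
      A.PosSemidef ∧ (idTensor (Fin n → Y') (tensor fun _ : Fin n => A)
        - regroup n Y' U' (tensor fun _ => C)).PosSemidef := by
    refine ⟨posSemidef_of_idTensor (by simpa using hA.add hC), ?_⟩
    rw [idTensor_tensor, ← map_sub]
    exact regroup_posSemidef (tensor_sub_posSemidef (fun _ => hC) fun _ => hA)
  induction i using Fin.induction with
  | zero =>
    obtain ⟨A, h1, h2⟩ := cert_zero_iff.1 hC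
    obtain ⟨hA, h⟩ := key h1 hC'
    refine ⟨_, h, ?_⟩
    have h0 := hA.trace_nonneg
    rw [trace_tensor, Finset.prod_const, Finset.card_univ, Fintype.card_fin,
      Complex.eq_re_of_ofReal_le h0, ← Complex.ofReal_pow, Complex.ofReal_re]
    exact pow_le_one₀ (Complex.nonneg_iff.1 h0).1 h2
  | succ i ih =>
    obtain ⟨A, h1, h2⟩ := cert_succ_iff.1 hC
    obtain ⟨hA, h⟩ := key h1 hC'
    refine cert_succ_iff.2 ⟨_, h, ?_⟩
    have : blockTrace ((E.pow n).next i) (tensor fun _ => A)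
        = regroup n _ _ (tensor fun _ => blockTrace (E.next i) A) := by
      ext t t'
      simp only [blockTrace, regroup_apply, tensor, of_apply, Fintype.prod_sum]
      rfl
    rw [this]
    exact ih h2 (blockTrace_posSemidef _ hA)

end History

/-! ### Realization of positive definite Choi operators by strategies -/

/-- The map `M ↦ K M Kᴴ`. -/
def krausMap {A B : Type*} [Fintype A] (K : Matrix B A ℂ) :
    Matrix A A ℂ →ₗ[ℂ] Matrix B B ℂ where
  toFun M := K * M * Kᴴ
  map_add' M N := by rw [Matrix.mul_add, Matrix.add_mul]
  map_smul' c M := by simp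

theorem isChannel_krausMap {A B : Type*} [Fintype A] [Fintype B] [DecidableEq A]
    {K : Matrix B A ℂ} (hK : Kᴴ * K = 1) : IsChannel (krausMap K) where
  completelyPositive d M hM := by
    let L : Matrix (B × Fin d) (A × Fin d) ℂ := Matrix.of fun t s => if t.2 = s.2 then K t.1 s.1 else 0
    convert hM.mul_mul_conjTranspose_same L using 1
    ext t t'
    simp only [mul_apply, conjTranspose_apply, L, of_apply, ampliate, krausMap, LinearMap.coe_mk,
      AddHom.coe_mk, apply_ite star, star_zero, mul_ite, ite_mul, zero_mul, mul_zero,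
      Fintype.sum_prod_type, Finset.sum_ite_eq, Finset.mem_univ, if_true]
  tracePreserving M := by
    change (K * M * Kᴴ).trace = _
    rw [trace_mul_comm, ← Matrix.mul_assoc, hK, Matrix.one_mul]

theorem ampliate_krausMap_vecMulVec {A B R : Type*} [Fintype A] (K : Matrix B A ℂ)
    (v : A × R → ℂ) : ampliate (krausMap K) R (vecMulVec v (star v)) =
      vecMulVec (fun t => ∑ a, K t.1 a * v (a, t.2)) (star fun t => ∑ a, K t.1 a * v (a, t.2)) := by
  ext t t'
  simp only [ampliate, krausMap, LinearMap.coe_mk, AddHom.coe_mk, of_apply, vecMulVec_apply,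
    mul_apply, conjTranspose_apply, Pi.star_apply, star_sum, star_mul', Finset.sum_mul,
    Finset.mul_sum]
  exact Finset.sum_congr rfl fun a _ => Finset.sum_congr rfl fun b _ => by ring

theorem conjTranspose_transpose_mul_transpose {A B : Type*} [Fintype A] [Fintype B]
    [DecidableEq A] {M : Matrix A B ℂ} (hM : M * Mᴴ = 1) : Mᵀᴴ * Mᵀ = 1 := by
  rw [show Mᵀᴴ = Mᴴᵀ from rfl, ← transpose_mul, hM, transpose_one]

namespace History

variable {m : ℕ} {X Y U : Fin (m + 1) → Type}

/-- The transpose of the Kraus operator of the prover's first channel. -/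
def firstKraus (E : History X Y U) {W : Type*} (S : Matrix (Y 0 × U 0) W ℂ) :
    Matrix (X 0) (Y 0 × W) ℂ :=
  Matrix.of fun x t => S (t.1, E.first.symm x) t.2

/-- The transpose of the Kraus operator of one of the prover's later channels. -/
def nextKraus (E : History X Y U) [∀ i, Fintype (Y i)] [∀ i, Fintype (U i)] (i : Fin m)
    {W W' : Type*} (T : Matrix W' (Y i.castSucc × U i.castSucc) ℂ)
    (S : Matrix (Y i.succ × U i.succ) W ℂ) : Matrix (X i.succ × W') (Y i.succ × W) ℂ :=
  Matrix.of fun s t => ∑ h, T s.2 h * S (t.1, (E.next i).symm (h, s.1)) t.2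

variable [∀ i, Fintype (Y i)] [∀ i, DecidableEq (X i)] [∀ i, DecidableEq (U i)]

theorem firstKraus_mul_conjTranspose (E : History X Y U)
    {R : ∀ i, Matrix (Y i × U i) (Y i × U i) ℂ} (hR : E.IsComb R) {W : Type*} [Fintype W]
    {S : Matrix (Y 0 × U 0) W ℂ} (hS : R 0 = S * Sᴴ) :
    E.firstKraus S * (E.firstKraus S)ᴴ = 1 := by
  ext x x'
  have h := hR.first (E.first.symm x) (E.first.symm x')
  rw [hS] at h
  simp only [mul_apply, conjTranspose_apply, EmbeddingLike.apply_eq_iff_eq] at h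
  simpa only [mul_apply, conjTranspose_apply, firstKraus, of_apply, Fintype.sum_prod_type,
    one_apply] using h

variable [∀ i, Fintype (U i)]

/-- The Choi constraint replaces `S Sᴴ`, summed over `Y`, by the previous operator, which `T`
normalizes to the identity. -/
theorem nextKraus_mul_conjTranspose (E : History X Y U)
    {R : ∀ i, Matrix (Y i × U i) (Y i × U i) ℂ} (hR : E.IsComb R) (i : Fin m) {W W' : Type*}
    [Fintype W] [DecidableEq W']
    {S : Matrix (Y i.succ × U i.succ) W ℂ} (hS : R i.succ = S * Sᴴ)
    {T : Matrix W' (Y i.castSucc × U i.castSucc) ℂ} (hT : T * R i.castSucc * Tᴴ = 1) :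
    E.nextKraus i T S * (E.nextKraus i T S)ᴴ = 1 := by
  ext ⟨x, w⟩ ⟨x', w'⟩
  have h (a a') : ∑ y, ∑ v, S (y, (E.next i).symm (a, x)) v *
      star (S (y, (E.next i).symm (a', x')) v) = if x = x' then R i.castSucc a a' else 0 := by
    have := hR.next i ((E.next i).symm (a, x)) ((E.next i).symm (a', x'))
    rw [hS] at this
    simpa only [mul_apply, conjTranspose_apply, Equiv.apply_symm_apply] using this
  have h' : (if x = x' then (T * R i.castSucc * Tᴴ) w w' else 0) =
      (1 : Matrix (X i.succ × W') (X i.succ × W') ℂ) (x, w) (x', w') := by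
    rw [hT]
    simp [one_apply, ite_and]
  rw [← h']
  have : (if x = x' then (T * R i.castSucc * Tᴴ) w w' else 0) =
      ∑ a', ∑ a, T w a * (if x = x' then R i.castSucc a a' else 0) * star (T w' a') := by
    split_ifs <;> simp [mul_apply, Finset.sum_mul]
  rw [this]
  simp only [← h, mul_apply, conjTranspose_apply, nextKraus, of_apply,
    Fintype.sum_prod_type (α₁ := Y i.succ) (α₂ := W), star_sum, star_mul', Finset.sum_mul, Finset.mul_sum]
  rw [sum_comm_pairs, Finset.sum_comm]
  exact Finset.sum_congr rfl fun a' _ => Finset.sum_congr rfl fun a _ =>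
    Finset.sum_congr rfl fun y _ => Finset.sum_congr rfl fun v _ => by ring

/-- Every positive definite operator that satisfies the constraints on Choi operators is the Choi
operator of a strategy. -/
theorem IsComb.exists_strategy [∀ i, Fintype (X i)] {E : History X Y U} {R : ∀ i, Matrix (Y i × U i) (Y i × U i) ℂ}
    (hR : E.IsComb R) (hR' : ∀ i, (R i).PosDef) : ∃ B : Strategy X Y, ∀ i, E.comb B i = R i := by
  classical
  -- `S i`, read as a vector, purifies `R i`. Definiteness gives the inverse `T i`, with which the
  -- next channel undoes the old purification before creating the new one.
  have hS (i) : ∃ S T : Matrix (Y i × U i) (Y i × U i) ℂ, R i = S * Sᴴ ∧ S * T = 1 ∧ T * S = 1 := by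
    obtain ⟨S, hS⟩ := exists_eq_mul_conjTranspose (hR' i).posSemidef
    have h := mul_nonsing_inv _ ((isUnit_iff_isUnit_det _).1 (hR' i).isUnit)
    nth_rewrite 1 [hS] at h
    rw [Matrix.mul_assoc] at h
    exact ⟨S, _, hS, h, mul_eq_one_comm.1 h⟩
  choose S T hRS hST hTS using hS
  have hT (i) : T i * R i * (T i)ᴴ = 1 := by
    rw [hRS, ← Matrix.mul_assoc, hTS, Matrix.one_mul, ← conjTranspose_mul, hTS, conjTranspose_one]
  let B : Strategy X Y :=
    { W := fun i => Y i × U i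
      first := krausMap (E.firstKraus (S 0))ᵀ
      next := fun i => krausMap (E.nextKraus i (T i.castSucc) (S i.succ))ᵀ
      isChannel_first := isChannel_krausMap (conjTranspose_transpose_mul_transpose
        (E.firstKraus_mul_conjTranspose hR (hRS 0)))
      isChannel_next := fun i => isChannel_krausMap (conjTranspose_transpose_mul_transpose
        (E.nextKraus_mul_conjTranspose hR i (hRS i.succ) (hT i.castSucc))) }
  -- Invariant of the run: the joint state is pure, with the prover holding the purifying space.
  have hB (i) : E.runUniversal B i = vecMulVec (fun t => S i t.1 t.2) (star fun t => S i t.1 t.2) := by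
    induction i using Fin.induction with
    | zero =>
      have h := ampliate_krausMap_vecMulVec (E.firstKraus (S 0))ᵀ E.initVec
      have h' : (fun t : (Y 0 × (Y 0 × U 0)) × U 0 =>
          ∑ a, (E.firstKraus (S 0))ᵀ t.1 a * E.initVec (a, t.2)) =
          fun t => S 0 (t.1.1, t.2) t.1.2 := by
        ext t
        simp [firstKraus, initVec]
      rw [h'] at h
      exact congrArg exchange h
    | succ i ih =>
      have h0 : exchange (ampliate (E.respond i) (B.W i.castSucc) (E.runUniversal B i.castSucc)) =
          vecMulVec (fun t => if (E.next i t.2).2 = t.1.1 then S i.castSucc (E.next i t.2).1 t.1.2 else 0)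
          (star fun t => if (E.next i t.2).2 = t.1.1 then S i.castSucc (E.next i t.2).1 t.1.2 else 0) := by
        rw [ih]
        ext t t'
        simp only [exchange, ampliate, respond, submatrix_apply, of_apply, LinearMap.coe_mk,
          AddHom.coe_mk, vecMulVec_apply, Pi.star_apply, apply_ite star, star_zero, ite_and,
          mul_ite, ite_mul, zero_mul, mul_zero]
        split_ifs <;> rfl
      have h := ampliate_krausMap_vecMulVec (R := U i.succ) (E.nextKraus i (T i.castSucc) (S i.succ))ᵀ
        (fun t => if (E.next i t.2).2 = t.1.1 then S i.castSucc (E.next i t.2).1 t.1.2 else 0)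
      have h' : (fun t : (Y i.succ × (Y i.succ × U i.succ)) × U i.succ =>
          ∑ a, (E.nextKraus i (T i.castSucc) (S i.succ))ᵀ t.1 a *
            (if (E.next i t.2).2 = a.1 then S i.castSucc (E.next i t.2).1 a.2 else 0)) =
          fun t => S i.succ (t.1.1, t.2) t.1.2 := by
        ext t
        simp only [nextKraus, transpose_apply, of_apply, Fintype.sum_prod_type (α₁ := X i.succ),
          mul_ite, mul_zero, Finset.sum_ite_irrel, Finset.sum_const_zero, Finset.sum_ite_eq,
          Finset.mem_univ, if_true, Finset.sum_mul]
        rw [Finset.sum_comm]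
        have h1 (a) : ∑ w, S i.castSucc (E.next i t.2).1 w * T i.castSucc w a =
            if (E.next i t.2).1 = a then 1 else 0 := by
          rw [← mul_apply, hST, one_apply]
        calc _ = ∑ a, S i.succ (t.1.1, (E.next i).symm (a, (E.next i t.2).2)) t.1.2 *
              ∑ w, S i.castSucc (E.next i t.2).1 w * T i.castSucc w a := by
              simp only [Finset.mul_sum]
              exact Finset.sum_congr rfl fun a _ => Finset.sum_congr rfl fun w _ => by ring
          _ = _ := by simp [h1]
      rw [runUniversal, run_succ, h0]
      rw [h'] at h
      exact congrArg exchange h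
  refine ⟨B, fun i => ?_⟩
  rw [comb, hB, hRS]
  ext t t'
  simp only [traceOut, vecMulVec_apply, mul_apply, of_apply, Pi.star_apply, conjTranspose_apply]
  rfl

end History

/-! ### Strong duality -/

/-- The annihilator of the kernel of `blockTrace` is the range of its adjoint `tensorId`. Matrix
units as `A` show this entrywise; `x` merely selects a diagonal block to read off. -/
theorem eq_tensorId_of_trace_mul_eq_zero {V H X : Type*} [Fintype V] [DecidableEq V] [Fintype X]
    [DecidableEq X] (e : V ≃ H × X) {M : Matrix V V ℂ}
    (hM : ∀ A, blockTrace e A = 0 → (A * M).trace = 0) (x : X) :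
    M = tensorId e (Matrix.of fun h h' => M (e.symm (h, x)) (e.symm (h', x))) := by
  classical
  have key (h h' : H) (y y' : X) : M (e.symm (h, y)) (e.symm (h', y')) =
      if y = y' then M (e.symm (h, x)) (e.symm (h', x)) else 0 := by
    split_ifs with hy
    · subst hy
      have := hM (single (e.symm (h', y)) (e.symm (h, y)) 1 -
        single (e.symm (h', x)) (e.symm (h, x)) 1) (by
          ext k k'
          simp [blockTrace, single_apply, Finset.sum_sub_distrib, ite_and])
      rw [sub_mul, trace_sub, sub_eq_zero] at this
      simpa [trace_single_mul] using this
    · have := hM (single (e.symm (h', y')) (e.symm (h, y)) 1) (by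
          ext k k'
          simp [blockTrace, single_apply, ite_and, hy])
      simpa [trace_single_mul] using this
  ext u u'
  have := key (e u).1 (e u').1 (e u).2 (e u').2
  simpa [tensorId] using this

theorem eq_zero_of_forall_mul_re_le {z : ℂ} (hz : ∀ c : ℂ, (c * z).re ≤ 1) : z = 0 := by
  by_contra h
  have h0 : 0 < Complex.normSq z := Complex.normSq_pos.2 h
  -- For this `c` the product `c * z` equals `2`.
  have := hz (((2 / Complex.normSq z : ℝ) : ℂ) * starRingEnd ℂ z)
  rw [mul_assoc, mul_comm (starRingEnd ℂ z), Complex.mul_conj, ← Complex.ofReal_mul,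
    Complex.ofReal_re, div_mul_cancel₀ _ h0.ne'] at this
  norm_num at this

theorem blockTrace_complex_smul {V H X : Type*} [Fintype X] (e : V ≃ H × X) (c : ℂ)
    (A : Matrix V V ℂ) : blockTrace e (c • A) = c • blockTrace e A := by
  ext; simp [blockTrace, Finset.mul_sum]

theorem blockTrace_conjTranspose {V H X : Type*} [Fintype X] (e : V ≃ H × X)
    (A : Matrix V V ℂ) : blockTrace e Aᴴ = (blockTrace e A)ᴴ := by
  ext; simp [blockTrace]

theorem idTensor_conjTranspose {Y V : Type*} [DecidableEq Y] (A : Matrix V V ℂ) :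
    idTensor Y Aᴴ = (idTensor Y A)ᴴ := by
  ext t t'
  by_cases h : t.1 = t'.1
  · simp [idTensor, h]
  · simp [idTensor, h, Ne.symm h]

theorem traceLeft_posSemidef {Y V : Type*} [Fintype Y] {M : Matrix (Y × V) (Y × V) ℂ}
    (hM : M.PosSemidef) : (traceLeft M).PosSemidef := by
  have : traceLeft M = ∑ y, M.submatrix (fun u => (y, u)) (fun u => (y, u)) := by
    ext u u'
    simp [traceLeft, Matrix.sum_apply]
  rw [this]
  exact posSemidef_sum _ fun y _ => hM.submatrix _

/-- Real linear functionals on matrices are real parts of complex trace pairings. -/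
theorem exists_eq_trace_mul_re {A : Type*} [Fintype A] (f : Matrix A A ℂ →ₗ[ℝ] ℝ) :
    ∃ R : Matrix A A ℂ, ∀ N, f N = (N * R).trace.re := by
  classical
  refine ⟨Matrix.of fun j i => (f (single i j 1) : ℂ) - f (single i j Complex.I) * Complex.I,
    fun N => ?_⟩
  have h (i j : A) : f (single i j (N i j)) =
      (N i j).re * f (single i j 1) + (N i j).im * f (single i j Complex.I) := by
    rw [← smul_eq_mul, ← smul_eq_mul, ← map_smul, ← map_smul, ← map_add, smul_single, smul_single,
      ← single_add]
    congr 2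
    simp [Complex.re_add_im]
  conv_lhs => rw [matrix_eq_sum_single N]
  simp only [map_sum, h, Matrix.trace, diag_apply, mul_apply, of_apply, Complex.re_sum]
  refine Finset.sum_congr rfl fun i _ => Finset.sum_congr rfl fun j _ => ?_
  simp

namespace History

variable {m : ℕ} {X Y U : Fin (m + 1) → Type} [∀ i, Fintype (X i)] [∀ i, Fintype (U i)]
  [∀ i, DecidableEq (Y i)] {E : History X Y U}

/-- Neither `C` nor `A` is required to be Hermitian in a certificate; this symmetry allows passing
to Hermitian parts. -/
theorem Cert.conjTranspose {i : Fin (m + 1)} {C : Matrix (Y i × U i) (Y i × U i) ℂ}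
    (hC : E.Cert i C) : E.Cert i Cᴴ := by
  induction i using Fin.induction with
  | zero =>
    obtain ⟨A, h1, h2⟩ := cert_zero_iff.1 hC
    refine cert_zero_iff.2 ⟨Aᴴ, ?_, by simpa [trace_conjTranspose] using h2⟩
    rw [idTensor_conjTranspose, ← conjTranspose_sub]
    exact h1.conjTranspose
  | succ i ih =>
    obtain ⟨A, h1, h2⟩ := cert_succ_iff.1 hC
    refine cert_succ_iff.2 ⟨Aᴴ, ?_, by rw [blockTrace_conjTranspose]; exact ih h2⟩
    rw [idTensor_conjTranspose, ← conjTranspose_sub]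
    exact h1.conjTranspose

theorem Cert.of_neg_posSemidef {i : Fin (m + 1)} {C : Matrix (Y i × U i) (Y i × U i) ℂ}
    (hC : (-C).PosSemidef) : E.Cert i C := by
  classical
  obtain ⟨s, hs, h⟩ := E.exists_cert_smul_one i
  refine h.mono ?_
  rw [sub_eq_add_neg]
  exact (smul_posSemidef PosSemidef.one hs.le).add hC

theorem cert_zero (i : Fin (m + 1)) : E.Cert i 0 :=
  Cert.of_neg_posSemidef (by rw [neg_zero]; exact PosSemidef.zero)

variable [∀ i, Fintype (Y i)]

/-- The polar of the set of operators with a dual certificate. -/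
def InPolar (E : History X Y U) (i : Fin (m + 1)) (R : Matrix (Y i × U i) (Y i × U i) ℂ) : Prop :=
  R.IsHermitian ∧ ∀ C, E.Cert i C → (C * R).trace.re ≤ 1

/-- All multiples `-t |v⟩⟨v|` with `t ≥ 0` are certified, so a negative expectation of `R` would
make the pairing unbounded. -/
theorem InPolar.posSemidef {i : Fin (m + 1)} {R : Matrix (Y i × U i) (Y i × U i) ℂ}
    (hR : E.InPolar i R) : R.PosSemidef := by
  refine PosSemidef.of_dotProduct_mulVec_nonneg hR.1 fun v => ?_
  have key (t : ℝ) (ht : 0 ≤ t) : -(t * (star v ⬝ᵥ (R *ᵥ v)).re) ≤ 1 := by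
    have h := hR.2 (-(t • vecMulVec v (star v))) (Cert.of_neg_posSemidef (by
      rw [neg_neg]
      exact smul_posSemidef (posSemidef_vecMulVec_self_star v) ht))
    have h' : (vecMulVec v (star v) * R).trace = star v ⬝ᵥ (R *ᵥ v) := by
      rw [vecMulVec_mul, trace_vecMulVec, dotProduct_comm, ← dotProduct_mulVec]
    simpa [h'] using h
  rw [Complex.nonneg_iff]
  refine ⟨?_, (hR.1.im_star_dotProduct_mulVec_self v).symm⟩
  by_contra! h
  have := key (-2 / (star v ⬝ᵥ (R *ᵥ v)).re) (by apply div_nonneg_of_nonpos <;> linarith)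
  rw [div_mul_cancel₀ _ h.ne] at this
  norm_num at this

/-- Restriction of an element of the polar to the previous round. -/
def restrict (E : History X Y U) (x : ∀ i, X i) (i : Fin m)
    (R : Matrix (Y i.succ × U i.succ) (Y i.succ × U i.succ) ℂ) :
    Matrix (Y i.castSucc × U i.castSucc) (Y i.castSucc × U i.castSucc) ℂ :=
  Matrix.of fun h h' => traceLeft R ((E.next i).symm (h, x i.succ))
    ((E.next i).symm (h', x i.succ))

variable [∀ i, DecidableEq (X i)]

/-- If `A` has zero block trace, `1 ⊗ c A` is certified for every complex `c`, so its bounded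
pairing with `R` must vanish. -/
theorem InPolar.traceLeft_eq {x : ∀ i, X i} {i : Fin m}
    {R : Matrix (Y i.succ × U i.succ) (Y i.succ × U i.succ) ℂ} (hR : E.InPolar i.succ R) :
    traceLeft R = tensorId (E.next i) (E.restrict x i R) := by
  classical
  refine eq_tensorId_of_trace_mul_eq_zero (E.next i) (fun A hA => ?_) (x i.succ)
  refine eq_zero_of_forall_mul_re_le fun c => ?_
  have := hR.2 (idTensor _ (c • A)) (cert_succ_iff.2 ⟨c • A, by rw [sub_self]; exact PosSemidef.zero, by
    rw [blockTrace_complex_smul, hA, smul_zero]; exact cert_zero _⟩)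
  rwa [trace_idTensor_mul, smul_mul, trace_smul, smul_eq_mul] at this

theorem InPolar.restrict {x : ∀ i, X i} {i : Fin m}
    {R : Matrix (Y i.succ × U i.succ) (Y i.succ × U i.succ) ℂ} (hR : E.InPolar i.succ R) :
    E.InPolar i.castSucc (E.restrict x i R) := by
  refine ⟨((traceLeft_posSemidef hR.posSemidef).submatrix fun h =>
    (E.next i).symm (h, x i.succ)).isHermitian, fun C hC => ?_⟩
  -- `C ⊗ |x⟩⟨x|` lifts a certified `C` to the next round.
  let A : Matrix (U i.succ) (U i.succ) ℂ := Matrix.of fun u u' =>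
    if (E.next i u).2 = x i.succ ∧ (E.next i u').2 = x i.succ then
      C (E.next i u).1 (E.next i u').1 else 0
  have hA : blockTrace (E.next i) A = C := by
    ext h h'
    simp [blockTrace, A]
  have := hR.2 (idTensor _ A) ⟨A, by rw [sub_self]; exact PosSemidef.zero, by rwa [hA]⟩
  rwa [trace_idTensor_mul, hR.traceLeft_eq (x := x), trace_mul_tensorId, hA] at this

/-- Every `1 ⊗ A` with `A` of trace zero, and all its multiples, are certified, so the partial trace
is a scalar. Only `r ≤ 1` results; the missing weight is restored later by mixing. -/
theorem InPolar.exists_sum_eq [Nonempty (X 0)] [∀ i, DecidableEq (U i)]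
    {R : Matrix (Y 0 × U 0) (Y 0 × U 0) ℂ} (hR : E.InPolar 0 R) :
    ∃ r : ℝ, r ≤ 1 ∧ ∀ u u', ∑ y, R (y, u) (y, u') = if u = u' then (r : ℂ) else 0 := by
  have key (A : Matrix (U 0) (U 0) ℂ) (hA : A.trace.re ≤ 1) : (A * traceLeft R).trace.re ≤ 1 := by
    rw [← trace_idTensor_mul]
    exact hR.2 _ ⟨A, by rw [sub_self]; exact PosSemidef.zero, hA⟩
  let e : U 0 ≃ Unit × X 0 := E.first.trans (Equiv.punitProd _).symm
  let u₀ : U 0 := E.first.symm (Classical.arbitrary _)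
  have h := eq_tensorId_of_trace_mul_eq_zero e (M := traceLeft R) (fun A hA => by
    refine eq_zero_of_forall_mul_re_le fun c => ?_
    have h0 : A.trace = 0 := by
      have := congrFun (congrFun hA ()) ()
      rw [Matrix.trace, ← E.first.symm.sum_comp]
      exact this
    have := key (c • A) (by simp [h0])
    rwa [smul_mul, trace_smul, smul_eq_mul] at this) (Classical.arbitrary _)
  have h0 : 0 ≤ traceLeft R u₀ u₀ := (traceLeft_posSemidef hR.posSemidef).diag_nonneg
  have h1 := key (single u₀ u₀ 1) (by simp)
  refine ⟨(traceLeft R u₀ u₀).re,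
    by simpa [trace_single_mul] using h1, fun u u' => ?_⟩
  rw [← Complex.eq_re_of_ofReal_le h0]
  refine (congrFun (congrFun h u) u').trans ?_
  have : (e u).2 = (e u').2 ↔ u = u' := E.first.apply_eq_iff_eq
  simp only [tensorId, of_apply, this]
  rfl

end History

namespace History

/-- The coefficients of the completely mixed Choi operators. -/
theorem exists_mixed_coefficients {m : ℕ} (Y : Fin (m + 1) → Type) [∀ i, Fintype (Y i)]
    [∀ i, Nonempty (Y i)] : ∃ t : Fin (m + 1) → ℝ, (∀ i, 0 < t i) ∧
      Fintype.card (Y 0) * t 0 = 1 ∧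
      ∀ i : Fin m, Fintype.card (Y i.succ) * t i.succ = t i.castSucc := by
  have hY (i) : (0 : ℝ) < Fintype.card (Y i) := Nat.cast_pos.2 Fintype.card_pos
  let t : Fin (m + 1) → ℝ := Fin.induction (motive := fun _ => ℝ) (1 / Fintype.card (Y 0))
    fun i s => s / Fintype.card (Y i.succ)
  have ht0 : t 0 = 1 / Fintype.card (Y 0) := rfl
  have ht (i : Fin m) : t i.succ = t i.castSucc / Fintype.card (Y i.succ) := rfl
  refine ⟨t, fun i => ?_, ?_, fun i => ?_⟩
  · induction i using Fin.induction with
    | zero => rw [ht0]; have := hY 0; positivity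
    | succ i ih => rw [ht]; exact div_pos ih (hY _)
  · rw [ht0, mul_one_div_cancel (hY 0).ne']
  · rw [ht, mul_div_cancel₀ _ (hY _).ne']

variable {m : ℕ} {X Y U : Fin (m + 1) → Type} [∀ i, Fintype (X i)] [∀ i, Fintype (Y i)]
  [∀ i, Fintype (U i)] [∀ i, DecidableEq (Y i)] [∀ i, DecidableEq (U i)] {E : History X Y U}

open scoped Matrix.Norms.L2Operator MatrixOrder in
/-- An operator without dual certificate is separated from those that have one. -/
theorem exists_inPolar_of_not_cert {i : Fin (m + 1)} {C : Matrix (Y i × U i) (Y i × U i) ℂ}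
    (hC : C.IsHermitian) (h : ¬ E.Cert i C) : ∃ R, E.InPolar i R ∧ (C * R).trace.re = 1 := by
  -- A certificate constrains the anti-Hermitian part of its operator to the form `1 ⊗ A`, so the
  -- certified set itself can have empty interior. Membership in `D` depends only on `N + Nᴴ`.
  let D : Set (Matrix (Y i × U i) (Y i × U i) ℂ) := {N | E.Cert i (N + Nᴴ)}
  have hD : Convex ℝ D := by
    intro N hN N' hN' a b ha hb hab
    have := E.convex_cert i hN hN' ha hb hab
    simp only [D, Set.mem_ofPred_eq] at this ⊢
    convert this using 1
    simp [conjTranspose_smul, smul_add]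
    abel
  have hmem {H : Matrix (Y i × U i) (Y i × U i) ℂ} (hH : E.Cert i H) : (1 / 2 : ℝ) • H ∈ D := by
    have := E.convex_cert i hH hH.conjTranspose (a := 1 / 2) (b := 1 / 2) (by norm_num)
      (by norm_num) (by norm_num)
    simpa [D, conjTranspose_smul] using this
  have h0 : (0 : Matrix (Y i × U i) (Y i × U i) ℂ) ∈ interior D := by
    obtain ⟨s, hs, hs'⟩ := E.exists_cert_smul_one i
    -- On this ball `N + Nᴴ` is dominated by its norm times `1`, hence by the certified `s • 1`.
    refine mem_interior.2 ⟨Metric.ball 0 (s / 2), fun N hN => ?_, Metric.isOpen_ball,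
      Metric.mem_ball_self (by linarith)⟩
    have h1 : ‖N + Nᴴ‖ ≤ s := by
      have := norm_add_le N Nᴴ
      rw [l2_opNorm_conjTranspose] at this
      have := mem_ball_zero_iff.1 hN
      linarith
    have h2 : IsSelfAdjoint (N + Nᴴ) := IsSelfAdjoint.add_star_self N
    refine hs'.mono ?_
    have h3 := h2.le_algebraMap_norm_self
    rw [Algebra.algebraMap_eq_smul_one, le_iff] at h3
    have h4 := h3.add (smul_posSemidef
      (PosSemidef.one (n := Y i × U i) (R := ℂ)) (sub_nonneg.2 h1))
    rwa [sub_smul, sub_add_sub_cancel'] at h4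
  have hC' : (1 / 2 : ℝ) • C ∉ interior D := fun hmem' => h <| by
    have := interior_subset hmem'
    simp only [D, Set.mem_ofPred_eq, conjTranspose_smul, hC.eq, star_trivial, ← add_smul] at this
    norm_num at this
    exact this
  obtain ⟨f, hf⟩ := geometric_hahn_banach_open_point hD.interior isOpen_interior hC'
  have hfD : ∀ N ∈ D, f N ≤ f ((1 / 2 : ℝ) • C) := by
    intro N hN
    have h1 : N ∈ closure (interior D) := by
      rw [hD.closure_interior_eq_closure_of_nonempty_interior ⟨0, h0⟩]
      exact subset_closure hN
    exact closure_minimal (fun a ha => (hf a ha).le) (isClosed_le f.continuous continuous_const) h1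
  have hpos : 0 < f C := by
    have := hf 0 h0
    rw [map_zero, map_smul, smul_eq_mul] at this
    linarith
  obtain ⟨R, hR⟩ := exists_eq_trace_mul_re f.toLinearMap
  have hR1 (N : Matrix (Y i × U i) (Y i × U i) ℂ) : f N = (N * R).trace.re := hR N
  have hR2 (N : Matrix (Y i × U i) (Y i × U i) ℂ) : f Nᴴ = (N * Rᴴ).trace.re := by
    rw [hR1, ← Complex.conj_re, ← Complex.star_def, ← trace_conjTranspose, conjTranspose_mul,
      conjTranspose_conjTranspose, trace_mul_comm]
  have hR3 (N : Matrix (Y i × U i) (Y i × U i) ℂ) :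
      (N * ((1 / (2 * f C)) • (R + Rᴴ))).trace.re = (f N + f Nᴴ) / (2 * f C) := by
    rw [hR1 N, hR2, Matrix.mul_smul, trace_smul, Complex.real_smul, Complex.re_ofReal_mul, Matrix.mul_add,
      trace_add, Complex.add_re]
    ring
  -- Symmetrizing makes the functional Hermitian; the factor normalizes its value at `C` to `1`.
  refine ⟨(1 / (2 * f C)) • (R + Rᴴ), ⟨?_, fun N hN => ?_⟩, ?_⟩
  · simp [IsHermitian, conjTranspose_smul, add_comm]
  · have h1 := hfD _ (hmem hN)
    have h2 := hfD _ (hmem hN.conjTranspose)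
    simp only [map_smul, smul_eq_mul] at h1 h2
    rw [hR3, div_le_one (by positivity)]
    linarith
  · rw [hR3, hC.eq, ← two_mul, div_self (by positivity)]

variable [∀ i, DecidableEq (X i)]

/-- Mixing with the completely mixed Choi operators gives positive definite operators that are
realized by a strategy. -/
theorem exists_strategy_mix [∀ i, Nonempty (Y i)] (E : History X Y U)
    {R : ∀ i, Matrix (Y i × U i) (Y i × U i) ℂ} (hR : ∀ i, (R i).PosSemidef) {r : ℝ}
    (hr1 : r ≤ 1)
    (h0 : ∀ u u', ∑ y, R 0 (y, u) (y, u') = if u = u' then (r : ℂ) else 0)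
    (hnext : ∀ i, traceLeft (R i.succ) = tensorId (E.next i) (R i.castSucc))
    {ε : ℝ} (hε : 0 < ε) (hε1 : ε ≤ 1) :
    ∃ B : Strategy X Y, ∀ i, ∃ s : ℝ, 0 < s ∧ E.comb B i = (1 - ε) • R i + s • 1 := by
  obtain ⟨t, ht, ht0, htn⟩ := exists_mixed_coefficients Y
  -- The normalization left over by `(1 - ε) • R`, to be supplied by the completely mixed part.
  have hc : 0 < 1 - (1 - ε) * r := by nlinarith
  have hs (i) : 0 < (1 - (1 - ε) * r) * t i := mul_pos hc (ht i)
  have hcomb : E.IsComb fun i => (1 - ε) • R i + ((1 - (1 - ε) * r) * t i) • 1 := by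
    refine ⟨fun i => ?_, fun u u' => ?_, fun i u u' => ?_⟩
    · exact (smul_posSemidef (hR i) (by linarith)).add (smul_posSemidef PosSemidef.one (hs i).le)
    · simp only [Matrix.add_apply, Matrix.smul_apply, Finset.sum_add_distrib, ← Finset.smul_sum, h0,
        one_apply, Prod.mk.injEq, true_and]
      split_ifs
      · have : (Fintype.card (Y 0) : ℂ) * t 0 = 1 := by exact_mod_cast ht0
        simp only [Finset.sum_const, Finset.card_univ, Complex.real_smul, nsmul_eq_mul, mul_one]
        push_cast
        linear_combination (1 - (1 - ε) * r : ℂ) * this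
      · simp
    · have h := congrFun (congrFun (hnext i) u) u'
      simp only [traceLeft, tensorId, of_apply] at h
      simp only [Matrix.add_apply, Matrix.smul_apply, Finset.sum_add_distrib, ← Finset.smul_sum, h,
        one_apply, Prod.mk.injEq, true_and]
      have h' : u = u' ↔ (E.next i u).2 = (E.next i u').2 ∧ (E.next i u).1 = (E.next i u').1 := by
        rw [← (E.next i).apply_eq_iff_eq, Prod.ext_iff, and_comm]
      simp only [h', ite_and]
      have : (Fintype.card (Y i.succ) : ℂ) * t i.succ = t i.castSucc := by exact_mod_cast htn i
      split_ifs
      · simp only [Finset.sum_const, Finset.card_univ, Complex.real_smul, nsmul_eq_mul, mul_one]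
        push_cast
        linear_combination (1 - (1 - ε) * r : ℂ) * this
      · simp
      · simp
  obtain ⟨B, hB⟩ := hcomb.exists_strategy fun i =>
    PosDef.posSemidef_add (smul_posSemidef (hR i) (by linarith)) (PosDef.one.smul (hs i))
  exact ⟨B, fun i => ⟨_, hs i, hB i⟩⟩

theorem nonempty_strategy [∀ i, Nonempty (Y i)] (E : History X Y U) : Nonempty (Strategy X Y) := by
  obtain ⟨B, -⟩ := E.exists_strategy_mix (R := fun _ => 0) (fun _ => PosSemidef.zero)
    (r := 0) zero_le_one (by simp) (fun i => by ext; simp [traceLeft, tensorId]) one_pos le_rfl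
  exact ⟨B⟩

/-- Strong duality. -/
theorem cert_of_forall_strategy [∀ i, Nonempty (X i)] [∀ i, Nonempty (Y i)] (E : History X Y U)
    {C : Matrix (Y (Fin.last m) × U (Fin.last m)) (Y (Fin.last m) × U (Fin.last m)) ℂ}
    (hC : C.PosSemidef) {c : ℝ} (hc : c < 1)
    (h : ∀ B, (C * E.comb B (Fin.last m)).trace.re ≤ c) : E.Cert (Fin.last m) C := by
  by_contra hnot
  obtain ⟨R₀, hR₀, hCR⟩ := exists_inPolar_of_not_cert hC.isHermitian hnot
  let x : ∀ i, X i := fun i => Classical.arbitrary _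
  -- The separating operator of the last round determines all earlier ones by restriction.
  let R : ∀ i, Matrix (Y i × U i) (Y i × U i) ℂ :=
    Fin.reverseInduction (motive := fun i => Matrix (Y i × U i) (Y i × U i) ℂ) R₀
      fun i => E.restrict x i
  have hlast : R (Fin.last m) = R₀ := Fin.reverseInduction_last
  have hcast (i : Fin m) : R i.castSucc = E.restrict x i (R i.succ) :=
    Fin.reverseInduction_castSucc i
  have hpolar (i) : E.InPolar i (R i) := by
    induction i using Fin.reverseInduction with
    | last => rwa [hlast]
    | cast i ih => rw [hcast]; exact ih.restrict
  obtain ⟨r, hr1, hr⟩ := (hpolar 0).exists_sum_eq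
  have hc0 : 0 ≤ c := by
    obtain ⟨B⟩ := E.nonempty_strategy
    exact (trace_mul_re_nonneg hC ((E.isComb_comb B).posSemidef _)).trans (h B)
  -- With this `ε` the strategy attains at least `1 - ε = (1 + c) / 2`, which exceeds `c`.
  obtain ⟨B, hB⟩ := E.exists_strategy_mix (fun i => (hpolar i).posSemidef) hr1 hr
    (fun i => by rw [hcast]; exact (hpolar i.succ).traceLeft_eq) (ε := (1 - c) / 2)
    (by linarith) (by linarith)
  obtain ⟨s, hs, hBs⟩ := hB (Fin.last m)
  have h1 := h B
  have h2 := trace_mul_re_nonneg hC (PosSemidef.one (R := ℂ) (n := Y (Fin.last m) × U (Fin.last m)))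
  rw [hBs, hlast, Matrix.mul_add, Matrix.mul_smul, Matrix.mul_smul, trace_add, trace_smul, trace_smul,
    Complex.add_re, Complex.real_smul, Complex.real_smul, Complex.re_ofReal_mul,
    Complex.re_ofReal_mul, hCR] at h1
  nlinarith [mul_nonneg hs.le h2]

end History

/-! ### Concentration -/

open MeasureTheory ProbabilityTheory in
/-- Hoeffding's lemma for Bernoulli variables. -/
theorem bernoulli_mgf_le {p : ℝ} (hp0 : 0 ≤ p) (hp1 : p ≤ 1) (t : ℝ) :
    1 + (Real.exp t - 1) * p ≤ Real.exp (t * p + t ^ 2 / 8) := by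
  let μ : Measure ℝ := ENNReal.ofReal p • Measure.dirac 1 + ENNReal.ofReal (1 - p) • Measure.dirac 0
  have hμ : IsProbabilityMeasure μ := ⟨by
    simp only [μ, Measure.add_apply, Measure.smul_apply, measure_univ, smul_eq_mul, mul_one]
    rw [← ENNReal.ofReal_add hp0 (by linarith), add_sub_cancel, ENNReal.ofReal_one]⟩
  have hint (f : ℝ → ℝ) : ∫ x, f x ∂μ = p * f 1 + (1 - p) * f 0 := by
    have hi (a : ℝ) (c : ℝ) : Integrable f (ENNReal.ofReal c • Measure.dirac a) :=
      (integrable_dirac (by simp)).smul_measure ENNReal.ofReal_ne_top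
    rw [integral_add_measure (hi _ _) (hi _ _), integral_smul_measure, integral_smul_measure,
      integral_dirac, integral_dirac, ENNReal.toReal_ofReal hp0,
      ENNReal.toReal_ofReal (by linarith)]
    rfl
  have hb : ∀ᵐ x ∂μ, id x ∈ Set.Icc (0 : ℝ) 1 := by
    rw [ae_add_measure_iff]
    exact ⟨Measure.ae_smul_measure (by simp [ae_dirac_eq]) _,
      Measure.ae_smul_measure (by simp [ae_dirac_eq]) _⟩
  have h := (hasSubgaussianMGF_of_mem_Icc aemeasurable_id hb).mgf_le t
  rw [mgf, hint, hint] at h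
  simp only [id, mul_one, mul_zero, add_zero, zero_sub, sub_zero, nnnorm_one] at h
  -- Hoeffding's lemma bounds the centred variable; the factor `exp (t p)` removes the centring.
  have h' := mul_le_mul_of_nonneg_left h (Real.exp_nonneg (t * p))
  rw [mul_add, mul_left_comm, ← Real.exp_add, mul_left_comm, ← Real.exp_add, ← Real.exp_add] at h'
  have e1 : t * p + t * (1 - p) = t := by ring
  have e2 : t * p + t * -p = 0 := by ring
  rw [e1, e2, Real.exp_zero] at h'
  calc _ = p * Real.exp t + (1 - p) * 1 := by ring
    _ ≤ _ := h'
    _ = _ := by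
      congr 2
      push_cast
      ring

/-! ### Interactions as measurements of the universal verifier. -/

namespace History

variable {m : ℕ} {X Y Z U : Fin (m + 1) → Type}
  [∀ i, Fintype (X i)] [∀ i, Fintype (Y i)] [∀ i, Fintype (Z i)] [∀ i, Fintype (U i)]
  [∀ i, DecidableEq (Y i)] [∀ i, DecidableEq (Z i)]

/-- Only the dimensions of the memories matter, so a recursion on cardinalities suffices. -/
theorem exists_history (X Y : Fin (m + 1) → Type) [∀ i, Fintype (X i)] [∀ i, Fintype (Y i)] :
    ∃ d : Fin (m + 1) → ℕ, Nonempty (History X Y fun i => Fin (d i)) := by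
  let d : Fin (m + 1) → ℕ := Fin.induction (motive := fun _ => ℕ) (Fintype.card (X 0))
    fun i k => Fintype.card (Y i.castSucc) * k * Fintype.card (X i.succ)
  refine ⟨d, ⟨Fintype.equivOfCardEq ?_, fun i => Fintype.equivOfCardEq ?_⟩⟩
  · rw [Fintype.card_fin]
    rfl
  · rw [Fintype.card_prod, Fintype.card_prod, Fintype.card_fin, Fintype.card_fin]
    rfl

/-- The measurement operators of an interaction, as operators of the universal verifier. -/
def outcomeOp (E : History X Y U) (V : Interaction X Y Z) (o : Fin 2) :
    Matrix (Y (Fin.last m) × U (Fin.last m)) (Y (Fin.last m) × U (Fin.last m)) ℂ :=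
  pullback (E.sim V.ρ V.Ψ (Fin.last m)) (V.P o)

theorem outcomeOp_posSemidef (E : History X Y U) (V : Interaction X Y Z) (o : Fin 2) :
    (E.outcomeOp V o).PosSemidef :=
  pullback_posSemidef (E.blocks_sim_posSemidef V.isDensity_ρ.posSemidef
    (fun i => (V.isChannel_Ψ i).completelyPositive) _) (V.isPOVM_P.posSemidef o)

variable [∀ i, DecidableEq (X i)]

theorem bornProb_outcomeOp (E : History X Y U) (V : Interaction X Y Z) (B : Strategy X Y)
    (o : Fin 2) : bornProb (E.outcomeOp V o) (E.comb B (Fin.last m)) =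
      bornProb (V.P o) (traceOut (run V.ρ V.Ψ B (Fin.last m))) :=
  (E.bornProb_run B (Fin.last m) (V.P o)).symm

theorem outcomeProb_eq (E : History X Y U) (V : Interaction X Y Z) (n : ℕ)
    (B : Interaction.ParallelStrategy n X Y) (o : Fin n → Fin 2) :
    V.outcomeProb n B o = bornProb (regroup n _ _ (tensor fun j => E.outcomeOp V (o j)))
      ((E.pow n).comb B (Fin.last m)) := by
  rw [Interaction.outcomeProb, Interaction.parallelState,
    (E.pow n).bornProb_run (Z := fun i => Fin n → Z i) B (Fin.last m)]
  congr 1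
  rw [funext₂ (E.sim_pow n (Fin.last m))]
  exact pullback_tensor _ _

end History

/-! ### Moment generating function and tail bound for the number of wins. -/

namespace Interaction

variable {m : ℕ} {X Y Z : Fin (m + 1) → Type}
  [∀ i, Fintype (X i)] [∀ i, Fintype (Y i)] [∀ i, Fintype (Z i)]
  [∀ i, DecidableEq (Y i)] [∀ i, DecidableEq (Z i)]

theorem trace_run (V : Interaction X Y Z) (B : Strategy X Y) (i : Fin (m + 1)) :
    (run V.ρ V.Ψ B i).trace = 1 :=
  (QPV.trace_run (fun i => (V.isChannel_Ψ i).tracePreserving) B i).trans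
    V.isDensity_ρ.trace_eq_one

theorem sum_bornProb (V : Interaction X Y Z) (B : Strategy X Y) :
    bornProb (V.P 0) (traceOut (run V.ρ V.Ψ B (Fin.last m))) + V.winProb B = 1 := by
  have h := V.isPOVM_P.sum_eq_one
  rw [Fin.sum_univ_two] at h
  rw [winProb, bornProb, bornProb, ← Complex.add_re, ← trace_add, ← Matrix.add_mul, h,
    Matrix.one_mul, trace_traceOut, trace_run, Complex.one_re]

/-- Applied to states of trace one, this yields the nonempty message spaces that duality needs. -/
theorem nonempty_of_trace_ne_zero {A : Type*} [Fintype A] {M : Matrix A A ℂ} (h : M.trace ≠ 0) :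
    Nonempty A := by
  by_contra hA
  rw [not_nonempty_iff] at hA
  exact h (by simp [Matrix.trace])

theorem nonempty_prover_message (V : Interaction X Y Z) (B : Strategy X Y) (i : Fin (m + 1)) :
    Nonempty (Y i) := by
  obtain ⟨t⟩ := nonempty_of_trace_ne_zero (by rw [V.trace_run B i]; exact one_ne_zero)
  exact ⟨t.1.1⟩

theorem nonempty_verifier_message (V : Interaction X Y Z) (B : Strategy X Y) (i : Fin (m + 1)) :
    Nonempty (X i) := by
  induction i using Fin.cases with
  | zero =>
    obtain ⟨t⟩ := nonempty_of_trace_ne_zero (by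
      rw [V.isDensity_ρ.trace_eq_one]; exact one_ne_zero)
    exact ⟨t.1⟩
  | succ i =>
    obtain ⟨t⟩ := nonempty_of_trace_ne_zero (M := ampliate (V.Ψ i) _ (run V.ρ V.Ψ B i.castSucc)) (by
      rw [trace_ampliate (V.isChannel_Ψ i).tracePreserving, V.trace_run]; exact one_ne_zero)
    exact ⟨t.1.1⟩

theorem winProb_mem_Icc (V : Interaction X Y Z) (B : Strategy X Y) :
    V.winProb B ∈ Set.Icc (0 : ℝ) 1 := by
  classical
  obtain ⟨d, ⟨E⟩⟩ := History.exists_history X Y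
  have h (o : Fin 2) : 0 ≤ bornProb (V.P o) (traceOut (run V.ρ V.Ψ B (Fin.last m))) := by
    rw [← E.bornProb_outcomeOp]
    exact trace_mul_re_nonneg (E.outcomeOp_posSemidef V o) ((E.isComb_comb B).posSemidef _)
  have := V.sum_bornProb B
  exact ⟨h 1, by linarith [h 0]⟩

/-- The moment generating function of the number of wins in `n` parallel instances is
submultiplicative. -/
theorem sum_exp_mul_outcomeProb_le [∀ i, Nonempty (X i)] [∀ i, Nonempty (Y i)]
    (V : Interaction X Y Z) {p : ℝ} (hp : ∀ B, V.winProb B ≤ p) (hp0 : 0 ≤ p) (n : ℕ)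
    (B : ParallelStrategy n X Y) {s : ℝ} (hs : 1 ≤ s) {ε : ℝ} (hε : 0 < ε) :
    ∑ o : Fin n → Fin 2, (∏ j, if o j = 1 then s else 1) * V.outcomeProb n B o ≤
      (1 + (s - 1) * p + ε) ^ n := by
  classical
  obtain ⟨d, ⟨E⟩⟩ := History.exists_history X Y
  -- The slack `ε` brings the normalized value strictly below `1`, as strong duality requires.
  set c : ℝ := 1 + (s - 1) * p + ε with hc
  have hc0 : 0 < c := by nlinarith [mul_nonneg (sub_nonneg.2 hs) hp0]
  let w (o : Fin 2) : ℝ := if o = 1 then s else 1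
  have hw (o) : 0 ≤ c⁻¹ * w o := by
    have : 0 ≤ w o := by simp only [w]; split_ifs <;> linarith
    positivity
  let C := ∑ o, ((c⁻¹ * w o : ℝ) : ℂ) • E.outcomeOp V o
  have hC : C.PosSemidef := posSemidef_sum _ fun o _ =>
    (E.outcomeOp_posSemidef V o).smul (by exact_mod_cast hw o)
  have hcert : E.Cert (Fin.last m) C := by
    refine E.cert_of_forall_strategy hC (c := (1 + (s - 1) * p) / c)
      ((div_lt_one hc0).2 (by linarith)) fun A => ?_
    have h1 := V.sum_bornProb A
    have h2 := hp A
    rw [winProb] at h1 h2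
    rw [← E.bornProb_outcomeOp, bornProb] at h1 h2
    rw [← E.bornProb_outcomeOp, bornProb] at h1
    simp only [C, Fin.sum_univ_two, w, Matrix.add_mul, Matrix.smul_mul, trace_add, trace_smul,
      smul_eq_mul, Complex.add_re, Complex.re_ofReal_mul]
    rw [le_div_iff₀ hc0]
    field_simp
    simp only [zero_ne_one, if_false, if_true]
    nlinarith [mul_le_mul_of_nonneg_left h2 (sub_nonneg.2 hs)]
  have h := (hcert.pow hC n).trace_mul_le ((E.pow n).isComb_comb B)
  -- Expanding the tensor power over outcome strings yields the weights `s ^ wins`, up to `c⁻¹ ^ n`.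
  have hsum : (regroup n _ _ (tensor fun _ : Fin n => C) *
      (E.pow n).comb B (Fin.last m)).trace.re =
      ∑ o : Fin n → Fin 2, (∏ j, c⁻¹ * w (o j)) * V.outcomeProb n B o := by
    simp only [C, tensor_sum, tensor_smul, map_sum, map_smul, Finset.sum_mul,
      trace_sum, Complex.re_sum, E.outcomeProb_eq, bornProb, ← Complex.ofReal_prod,
      Matrix.smul_mul, trace_smul, smul_eq_mul, Complex.re_ofReal_mul]
  rw [hsum] at h
  simp only [Finset.prod_mul_distrib, Finset.prod_const, Finset.card_univ, Fintype.card_fin,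
    mul_assoc, ← Finset.mul_sum] at h
  rwa [inv_pow, inv_mul_le_iff₀ (by positivity), mul_one] at h

theorem outcomeProb_nonneg (V : Interaction X Y Z) (n : ℕ)
    (B : ParallelStrategy n X Y) (o : Fin n → Fin 2) : 0 ≤ V.outcomeProb n B o := by
  classical
  obtain ⟨d, ⟨E⟩⟩ := History.exists_history X Y
  rw [E.outcomeProb_eq]
  exact trace_mul_re_nonneg (regroup_posSemidef (tensor_posSemidef fun j =>
    E.outcomeOp_posSemidef V _)) (((E.pow n).isComb_comb B).posSemidef _)

theorem atLeastProb_le [∀ i, Nonempty (X i)] [∀ i, Nonempty (Y i)]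
    (V : Interaction X Y Z) {p : ℝ} (hp : ∀ B, V.winProb B ≤ p) (hp0 : 0 ≤ p) (hp1 : p ≤ 1)
    {n k : ℕ} (B : ParallelStrategy n X Y) {δ : ℝ} (hδ : 0 < δ) (hk : (k : ℝ) = n * (p + δ)) :
    V.atLeastProb n k B ≤ Real.exp (-2 * n * δ ^ 2) := by
  -- `t = 4 δ` minimizes the Chernoff exponent `t ^ 2 / 8 - t δ`, with minimum `-2 δ ^ 2`.
  set s : ℝ := Real.exp (4 * δ) with hs
  have hs1 : 1 ≤ s := Real.one_le_exp (by linarith)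
  have key (ε : ℝ) (hε : 0 < ε) : s ^ k * V.atLeastProb n k B ≤ (1 + (s - 1) * p + ε) ^ n := by
    refine le_trans ?_ (V.sum_exp_mul_outcomeProb_le hp hp0 n B hs1 hε)
    rw [atLeastProb, Finset.mul_sum]
    refine (Finset.sum_le_sum fun o ho => ?_).trans (Finset.sum_le_univ_sum_of_nonneg fun o => ?_)
    · refine mul_le_mul_of_nonneg_right ?_ (V.outcomeProb_nonneg n B o)
      rw [Finset.prod_ite, Finset.prod_const, Finset.prod_const_one, mul_one]
      exact pow_le_pow_right₀ hs1 (Finset.mem_filter.1 ho).2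
    · refine mul_nonneg (Finset.prod_nonneg fun j _ => ?_) (V.outcomeProb_nonneg n B o)
      split_ifs <;> linarith
  have hlim : s ^ k * V.atLeastProb n k B ≤ (1 + (s - 1) * p) ^ n := by
    refine ge_of_tendsto (f := fun ε : ℝ => (1 + (s - 1) * p + ε) ^ n)
      (x := nhdsWithin 0 (Set.Ioi 0)) ?_ (eventually_nhdsWithin_of_forall key)
    have : Continuous fun ε : ℝ => (1 + (s - 1) * p + ε) ^ n := by fun_prop
    simpa using (this.tendsto 0).mono_left nhdsWithin_le_nhds
  have hpow : (1 + (s - 1) * p) ^ n ≤ Real.exp (4 * δ * p + (4 * δ) ^ 2 / 8) ^ n :=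
    pow_le_pow_left₀ (by nlinarith) (bernoulli_mgf_le hp0 hp1 (4 * δ)) n
  have h := hlim.trans hpow
  rw [hs, ← Real.exp_nat_mul, ← Real.exp_nat_mul, ← le_div_iff₀' (Real.exp_pos _),
    ← Real.exp_sub, hk] at h
  exact h.trans (Real.exp_le_exp.2 (le_of_eq (by ring)))

end Interaction

end QPV

end

theorem theorem3 {m : ℕ} {X Y Z : Fin (m + 1) → Type}
    [∀ i, Fintype (X i)] [∀ i, Fintype (Y i)] [∀ i, Fintype (Z i)]
    [∀ i, DecidableEq (Y i)] [∀ i, DecidableEq (Z i)]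
    (V : QPV.Interaction X Y Z) (p : ℝ) (hp : IsLUB V.winProbs p)
    (n k : ℕ) (δ : ℝ) (hδ : 0 < δ) (hk : (k : ℝ) = n * (p + δ)) :
    ∃ q : ℝ, IsLUB (V.atLeastProbs n k) q ∧ q ≤ Real.exp (-2 * n * δ ^ 2) := by
  classical
  -- The empty set has no least upper bound in `ℝ`, so a strategy exists.
  obtain ⟨_, A, rfl⟩ := hp.nonempty
  have hX := V.nonempty_verifier_message A
  have hY := V.nonempty_prover_message A
  have hwin : ∀ A, V.winProb A ≤ p := fun A => hp.1 ⟨A, rfl⟩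
  have hp0 : 0 ≤ p := (V.winProb_mem_Icc A).1.trans (hwin A)
  have hp1 : p ≤ 1 := hp.2 (by rintro _ ⟨A, rfl⟩; exact (V.winProb_mem_Icc A).2)
  have hbound : Real.exp (-2 * n * δ ^ 2) ∈ upperBounds (V.atLeastProbs n k) := by
    rintro _ ⟨B, rfl⟩
    exact V.atLeastProb_le hwin hp0 hp1 B hδ hk
  obtain ⟨d, ⟨E⟩⟩ := QPV.History.exists_history X Y
  obtain ⟨B⟩ := (E.pow n).nonempty_strategy
  obtain ⟨q, hq⟩ := Real.exists_isLUB (s := V.atLeastProbs n k) ⟨_, B, rfl⟩ ⟨_, hbound⟩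
  exact ⟨q, hq, hq.2 hbound⟩
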